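/- **Setting.** Let $U,V$ be square-integrable real random variables on a probability space $(\Omega,\mathcal F,\mathbb P)$, let $Y=(U,V)$ and let $\nu$ be the law of $Y$ on $\mathbb R^2$. Write $c(x,y)=(x_1-y_1)(x_2-y_2)$ for $x,y\in\mathbb R^2$. Equalities between random variables are understood almost surely. *Equilibrium.* $U$ is the order of the noise traders and $V$ the terminal value of a stock. An equilibrium is a pair $(Q,f)$ of a real-valued $(U,V)$-measurable random variable $Q$ (the insider's order) and a Borel function $f:\mathbb R\to[-\infty,\infty]$ (the pricing rule) such that (i) $f(Q+U)=\mathbb E[V\mid Q+U]$ and (ii) almost surely $Q\,(V-f(Q+U))=\max_{q\in\mathbb R} q\,(V-f(q+U))$, where $0\times\infty=0$. The random variable $Q\,(V-f(Q+U))$ is the insider's profit. *Plans.* Let $\Gamma(\nu)$ be the set of probability measures $\gamma(dx,dy)$ on $\mathbb R^2\times\mathbb R^2$ with finite second moments and $y$-marginal $\nu$ under which the conditional expectation of $y$ given $x$ is $x$. An optimal plan is a minimizer of $\int c(x,y)\,d\gamma$ over $\gamma\in\Gamma(\nu)$. *Maps.* Let $\mathcal X(Y)$ be the set of square-integrable $Y$-measurable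 random variables $X$ with values in $\mathbb R^2$ and $\mathbb E[Y\mid X]=X$. An optimal map is a minimizer of $\mathbb E[c(X,Y)]$ over $X\in\mathcal X(Y)$. *Dual problem.* A set $G\subset\mathbb R^2$ is monotone if $c(r,s)\ge 0$ for all $r,s\in G$, and maximal monotone if it is not a proper subset of a monotone set. Put $\phi_G(y)=\inf_{x\in G}c(x,y)\in[-\infty,\infty)$; if $G$ is maximal monotone, then $\phi_G\le 0$. A dual maximizer is a maximal monotone set $G$ that maximizes $\int\phi_G\,d\nu\in[-\infty,0]$ over all maximal monotone sets. **Theorem.** 1. An equilibrium exists if and only if there is an optimal map $X$ such that the law of $(X,Y)$ is an optimal plan. 2. The insider's profit is unique: it is the same random variable in all equilibria. If $(Q,f)$ is an equilibrium, then a dual maximizer exists, and $$Q\,(V-f(Q+U))=-c(X,Y)=-\phi_G(U,V)$$ for every optimal map $X$ and every dual maximizer $G$. 3. If an equilibrium exists, then there are an equilibrium $(Q,f)$ and an optimal map $X=(R,S)$, the law of $(X,Y)$ being an optimal plan, such that $f:\mathbb R\to[-\infty,\infty]$ is an increasing (that is, nondecreasing) function, the total order is $Q+U=R$, and the price is $f(Q+U)=S$.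 -/

import Mathlib

open MeasureTheory ProbabilityTheory

namespace KyleOT

noncomputable section

/-- The covariance-type cost `c(x,y) = (x₁ - y₁)(x₂ - y₂)` on the plane. -/
def cost (x y : ℝ × ℝ) : ℝ := (x.1 - y.1) * (x.2 - y.2)

/-- The backward martingale plans `Γ(ν)`: probability measures `γ(dx,dy)` on `ℝ² × ℝ²` with finite
second moments and `y`-marginal `ν`, such that the conditional expectation of `y` given `x`
is `x` (coordinate by coordinate). -/
structure IsPlan (ν : Measure (ℝ × ℝ)) (γ : Measure ((ℝ × ℝ) × (ℝ × ℝ))) : Prop where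
  isProb : IsProbabilityMeasure γ
  memLp : MemLp id 2 γ
  marginal : γ.map Prod.snd = ν
  martingale_fst :
    γ[fun z => z.2.1 | MeasurableSpace.comap Prod.fst inferInstance] =ᵐ[γ] fun z => z.1.1
  martingale_snd :
    γ[fun z => z.2.2 | MeasurableSpace.comap Prod.fst inferInstance] =ᵐ[γ] fun z => z.1.2

/-- `γ` minimizes `∫ c(x,y) dγ` over `Γ(ν)`. -/
def IsOptimalPlan (ν : Measure (ℝ × ℝ)) (γ : Measure ((ℝ × ℝ) × (ℝ × ℝ))) : Prop :=
  IsPlan ν γ ∧ ∀ γ', IsPlan ν γ' → ∫ z, cost z.1 z.2 ∂γ ≤ ∫ z, cost z.1 z.2 ∂γ'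

/-- A set in the plane is monotone if `c(r,s) ≥ 0` for all its points `r`, `s`. -/
def IsMonotoneSet (G : Set (ℝ × ℝ)) : Prop := ∀ r ∈ G, ∀ s ∈ G, 0 ≤ cost r s

/-- A monotone set that is not a proper subset of a monotone set. -/
def IsMaximalMonotone (G : Set (ℝ × ℝ)) : Prop := Maximal IsMonotoneSet G

/-- `φ_G(y) = inf_{x ∈ G} c(x,y)`, an extended real number. -/
def phi (G : Set (ℝ × ℝ)) (y : ℝ × ℝ) : EReal := ⨅ x ∈ G, ((cost x y : ℝ) : EReal)

/-- The integral `∫ φ_G dν ∈ [-∞,0]` for `G` maximal monotone. As then `φ_G ≤ 0`,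
it is minus the Lebesgue integral of the nonnegative function `-φ_G`. -/
def dualValue (ν : Measure (ℝ × ℝ)) (G : Set (ℝ × ℝ)) : EReal :=
  -((∫⁻ y, (-phi G y).toENNReal ∂ν : ENNReal) : EReal)

/-- `G` maximizes `∫ φ_G dν` over all maximal monotone sets. -/
def IsDualMaximizer (ν : Measure (ℝ × ℝ)) (G : Set (ℝ × ℝ)) : Prop :=
  IsMaximalMonotone G ∧ ∀ G', IsMaximalMonotone G' → dualValue ν G' ≤ dualValue ν G

variable {Ω : Type*} [MeasurableSpace Ω]

/-- The admissible maps `𝒳(Y)`: square-integrable planar random variables `X` that are measurable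
with respect to the `σ`-algebra of `Y` and satisfy `E[Y | X] = X` almost surely. -/
structure IsMap (P : Measure Ω) (Y X : Ω → ℝ × ℝ) : Prop where
  memLp : MemLp X 2 P
  measurable : Measurable[MeasurableSpace.comap Y inferInstance] X
  martingale_fst :
    P[fun ω => (Y ω).1 | MeasurableSpace.comap X inferInstance] =ᵐ[P] fun ω => (X ω).1
  martingale_snd :
    P[fun ω => (Y ω).2 | MeasurableSpace.comap X inferInstance] =ᵐ[P] fun ω => (X ω).2

/-- `X` minimizes `E[c(X,Y)]` over `𝒳(Y)`. -/
def IsOptimalMap (P : Measure Ω) (Y X : Ω → ℝ × ℝ) : Prop :=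
  IsMap P Y X ∧
    ∀ X', IsMap P Y X' → ∫ ω, cost (X ω) (Y ω) ∂P ≤ ∫ ω, cost (X' ω) (Y ω) ∂P

/-- The profit `q (v - f(q + u))` from the order `q`, when the noise traders order `u`, the terminal
value is `v` and the pricing rule is `f`. In `EReal` one has `0 * (±∞) = 0`. -/
def profit (f : ℝ → EReal) (u v q : ℝ) : EReal := (q : EReal) * ((v : EReal) - f (q + u))

/-- `(Q, f)` is an equilibrium: the order `Q` is `(U,V)`-measurable, the pricing rule `f` is Borel,
the price `f(Q + U)` is `E[V | Q + U]`, and almost surely `Q` attains the maximum of the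
profit over all orders `q ∈ ℝ`. -/
structure IsEquilibrium (P : Measure Ω) (U V Q : Ω → ℝ) (f : ℝ → EReal) : Prop where
  measurable_order :
    Measurable[MeasurableSpace.comap (fun ω => (U ω, V ω)) inferInstance] Q
  measurable_rule : Measurable f
  efficient : ∀ᵐ ω ∂P, f (Q ω + U ω) =
    (((P[V | MeasurableSpace.comap (fun ω' => Q ω' + U ω') inferInstance]) ω : ℝ) : EReal)
  optimal : ∀ᵐ ω ∂P, ∀ q : ℝ, profit f (U ω) (V ω) q ≤ profit f (U ω) (V ω) (Q ω)

end

end KyleOT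

/-! The engine is a duality between maps with X = E[Y | X] and maximal monotone sets G. Expanding
around X, c(g, Y) is c(X, Y) + c(g, X) plus terms of conditional mean zero. Some g in G has c(g, X)
≤ 0, so E[φ_G(Y)] ≤ E[c(X, Y)], and equality forces X ∈ G and φ_G(Y) = c(X, Y) (`weak_duality`,
`IsPlan.duality`). A plan and a set without gap are thus both optimal, and they determine φ_G(Y) and
c(X, Y) for all other optimizers.

The sets G come from scalar bounds. For y = (u, v), the bound c(·, y) ≥ -k on G puts G above v -
k/(r - u) at abscissae r > u and below v + k/(u - r) at r < u. Such barriers can be met together as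
soon as they are compatible in pairs (`exists_maximalMonotone_of_pairwise`).

In an equilibrium, k is the profit: the price f(r) itself separates the barriers. With R = Q + U and
X = E[Y | R], the mean of c(X, Y) is minus the mean profit, so there is no gap
(`IsEquilibrium.exists_map`).

Conversely, for an optimal plan, merging a little mass near two support points at their barycenter
cannot lower the cost. This gives the compatibility with k = -c(x, y)
(`IsOptimalPlan.support_pair`), hence a set G without gap. Averaging the price given the order makes
it a function of the order, and a selection of G serves as pricing rule: it bounds all profits by
-φ_G, which Q = R - U attains (`exists_monotone_equilibrium`). -/

namespace KyleOT

/-! ### The cost and maximal monotone sets -/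

lemma cost_self (x : ℝ × ℝ) : cost x x = 0 := by simp [cost]

lemma cost_comm (x y : ℝ × ℝ) : cost x y = cost y x := by simp only [cost]; ring

/-- The expansion of `c(g, y)` around a third point `x`. -/
lemma cost_eq_add (g x y : ℝ × ℝ) : cost g y = cost x y + cost g x
    + ((g.1 - x.1) * (x.2 - y.2) + (g.2 - x.2) * (x.1 - y.1)) := by
  simp only [cost]; ring

lemma continuous_cost : Continuous fun z : (ℝ × ℝ) × (ℝ × ℝ) => cost z.1 z.2 := by
  unfold cost; fun_prop

lemma measurable_cost : Measurable fun z : (ℝ × ℝ) × (ℝ × ℝ) => cost z.1 z.2 :=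
  continuous_cost.measurable

lemma mem_of_forall_cost_nonneg {G : Set (ℝ × ℝ)} (hG : IsMaximalMonotone G) {x : ℝ × ℝ}
    (hx : ∀ g ∈ G, 0 ≤ cost g x) : x ∈ G := by
  have hmono : IsMonotoneSet (insert x G) := by
    rintro r (rfl | hr) s (rfl | hs)
    · exact (cost_self _).ge
    · rw [cost_comm]; exact hx s hs
    · exact hx r hr
    · exact hG.1 r hr s hs
  exact hG.2 hmono (Set.subset_insert x G) (Set.mem_insert x G)

/-- If c(·, x) were positive on all of G, maximality would put x into G, where c(x, x) = 0. -/
lemma exists_cost_nonpos {G : Set (ℝ × ℝ)} (hG : IsMaximalMonotone G) (x : ℝ × ℝ) :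
    ∃ g ∈ G, cost g x ≤ 0 := by
  by_contra! h
  have hx := mem_of_forall_cost_nonneg hG fun g hg => (h g hg).le
  exact (h x hx).ne' (cost_self x)

lemma exists_countable_dense (G : Set (ℝ × ℝ)) : ∃ D ⊆ G, D.Countable ∧ G ⊆ closure D :=
  (TopologicalSpace.IsSeparable.of_separableSpace G).exists_countable_dense_subset

lemma le_cost_of_dense {D G : Set (ℝ × ℝ)} (hD : G ⊆ closure D) {x : ℝ × ℝ} {a : ℝ}
    (h : ∀ g ∈ D, a ≤ cost g x) : ∀ g ∈ G, a ≤ cost g x := by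
  have hc : IsClosed {g : ℝ × ℝ | a ≤ cost g x} :=
    isClosed_le continuous_const (by unfold cost; fun_prop)
  exact fun g hg => hc.closure_subset_iff.2 h (hD hg)

/-! ### Weak duality -/

section Integrability

variable {α : Type*} {m0 : MeasurableSpace α} {μ : Measure α}

lemma integrable_mul_of_memLp {f g : α → ℝ} (hf : MemLp f 2 μ) (hg : MemLp g 2 μ) :
    Integrable (fun ω => f ω * g ω) μ := MemLp.integrable_mul hf hg

lemma integrable_cost {X Y : α → ℝ × ℝ} (hX : MemLp X 2 μ) (hY : MemLp Y 2 μ) :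
    Integrable (fun ω => cost (X ω) (Y ω)) μ :=
  integrable_mul_of_memLp (hX.fst.sub hY.fst) (hX.snd.sub hY.snd)

lemma condExp_mul_eq_zero {m : MeasurableSpace α} {f g : α → ℝ} (hf : Measurable[m] f)
    (hfg : Integrable (fun ω => f ω * g ω) μ) (hg : Integrable g μ) (h0 : μ[g | m] =ᵐ[μ] 0) :
    μ[fun ω => f ω * g ω | m] =ᵐ[μ] 0 := by
  have h := condExp_mul_of_stronglyMeasurable_left hf.stronglyMeasurable hfg hg
  filter_upwards [h, h0] with ω h1 h2
  change (μ[f * g | m]) ω = _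
  rw [h1]; simp [h2]

lemma integral_mul_eq_zero [IsFiniteMeasure μ] {m : MeasurableSpace α} (hm : m ≤ m0)
    {f g : α → ℝ} (hf : Measurable[m] f)
    (hfg : Integrable (fun ω => f ω * g ω) μ) (hg : Integrable g μ) (h0 : μ[g | m] =ᵐ[μ] 0) :
    ∫ ω, f ω * g ω ∂μ = 0 := by
  rw [← integral_condExp hm, integral_congr_ae (condExp_mul_eq_zero hf hfg hg h0)]
  simp

lemma condExp_sub_eq_zero [IsFiniteMeasure μ] {m : MeasurableSpace α} (hm : m ≤ m0)
    {f g : α → ℝ} (hf : Measurable[m] f) (hfi : Integrable f μ) (hg : Integrable g μ)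
    (h : μ[g | m] =ᵐ[μ] f) : μ[fun ω => f ω - g ω | m] =ᵐ[μ] 0 := by
  have h1 := condExp_sub hfi hg m
  have h2 : μ[f | m] = f := condExp_of_stronglyMeasurable hm hf.stronglyMeasurable hfi
  filter_upwards [h1, h] with ω h3 h4
  change (μ[f - g | m]) ω = _
  rw [h3]; simp [h2, h4]

/-- Weak duality: if `X = E[Y | m]` and `ψ ≤ c(g, Y)` for all `g` in a maximal monotone set, then
`E[ψ] ≤ E[c(X, Y)]`; in the case of equality `ψ = c(X, Y)` and `X` lies in the set. -/
theorem weak_duality [IsFiniteMeasure μ] {m : MeasurableSpace α} (hm : m ≤ m0)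
    {X Y : α → ℝ × ℝ} (hX : Measurable[m] X) (hX2 : MemLp X 2 μ) (hY2 : MemLp Y 2 μ)
    (h1 : μ[fun ω => (Y ω).1 | m] =ᵐ[μ] fun ω => (X ω).1)
    (h2 : μ[fun ω => (Y ω).2 | m] =ᵐ[μ] fun ω => (X ω).2)
    {G : Set (ℝ × ℝ)} (hG : IsMaximalMonotone G) {ψ : α → ℝ} (hψ : Integrable ψ μ)
    (hle : ∀ᵐ ω ∂μ, ∀ g ∈ G, ψ ω ≤ cost g (Y ω)) :
    ∫ ω, ψ ω ∂μ ≤ ∫ ω, cost (X ω) (Y ω) ∂μ ∧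
      (∫ ω, ψ ω ∂μ = ∫ ω, cost (X ω) (Y ω) ∂μ →
        ∀ᵐ ω ∂μ, ψ ω = cost (X ω) (Y ω) ∧ X ω ∈ G) := by
  -- The exceptional null set below depends on g; a countable dense part of G leaves a single one.
  obtain ⟨D, hDG, hDc, hDd⟩ := exists_countable_dense G
  have hX1 : Measurable[m] fun ω => (X ω).1 := measurable_fst.comp hX
  have hX2' : Measurable[m] fun ω => (X ω).2 := measurable_snd.comp hX
  have hc := integrable_cost hX2 hY2
  have iX1 := hX2.fst.integrable one_le_two
  have iX2 := hX2.snd.integrable one_le_two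
  have iY1 := hY2.fst.integrable one_le_two
  have iY2 := hY2.snd.integrable one_le_two
  have e1 := condExp_sub_eq_zero hm hX1 iX1 iY1 h1
  have e2 := condExp_sub_eq_zero hm hX2' iX2 iY2 h2
  set e := μ[fun ω => ψ ω - cost (X ω) (Y ω) | m] with he
  -- Both cross terms of `cost_eq_add` are an m-measurable factor times a coordinate of X - Y, so
  -- their conditional means vanish.
  have key : ∀ g ∈ D, ∀ᵐ ω ∂μ, e ω ≤ cost g (X ω) := by
    intro g hg
    have mg : Measurable[m] fun ω => cost g (X ω) :=
      Measurable.mul (measurable_const.sub hX1) (measurable_const.sub hX2')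
    have hgc : MemLp (fun _ : α => g) 2 μ := memLp_const g
    have ig : Integrable (fun ω => cost g (X ω)) μ := integrable_cost hgc hX2
    have p1 : Integrable (fun ω => (g.1 - (X ω).1) * ((X ω).2 - (Y ω).2)) μ :=
      integrable_mul_of_memLp (hgc.fst.sub hX2.fst) (hX2.snd.sub hY2.snd)
    have p2 : Integrable (fun ω => (g.2 - (X ω).2) * ((X ω).1 - (Y ω).1)) μ :=
      integrable_mul_of_memLp (hgc.snd.sub hX2.snd) (hX2.fst.sub hY2.fst)
    have z1 := condExp_mul_eq_zero (μ := μ) (m := m)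
      (f := fun ω => g.1 - (X ω).1) (g := fun ω => (X ω).2 - (Y ω).2)
      (measurable_const.sub hX1) p1 (iX2.sub iY2) e2
    have z2 := condExp_mul_eq_zero (μ := μ) (m := m)
      (f := fun ω => g.2 - (X ω).2) (g := fun ω => (X ω).1 - (Y ω).1)
      (measurable_const.sub hX2') p2 (iX1.sub iY1) e1
    have hmono := condExp_mono (m := m) (hψ.sub hc) (ig.add (p1.add p2)) (by
      filter_upwards [hle] with ω hω
      have := hω g (hDG hg)
      rw [cost_eq_add g (X ω) (Y ω)] at this
      simp only [Pi.sub_apply, Pi.add_apply]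
      linarith)
    have s1 := condExp_add (m := m) ig (p1.add p2)
    have s2 := condExp_add (m := m) p1 p2
    have s3 : μ[fun ω => cost g (X ω) | m] = fun ω => cost g (X ω) :=
      condExp_of_stronglyMeasurable hm mg.stronglyMeasurable ig
    filter_upwards [hmono, s1, s2, z1, z2] with ω q1 q2 q3 q4 q5
    rw [q2, Pi.add_apply, q3, Pi.add_apply, q4, q5, s3] at q1
    simp only [Pi.zero_apply, add_zero] at q1
    exact q1
  have key' : ∀ᵐ ω ∂μ, ∀ g ∈ G, e ω ≤ cost g (X ω) := by
    filter_upwards [(ae_ball_iff hDc).2 key] with ω hω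
    exact le_cost_of_dense hDd hω
  have hneg : ∀ᵐ ω ∂μ, e ω ≤ 0 := by
    filter_upwards [key'] with ω hω
    obtain ⟨g, hg, h⟩ := exists_cost_nonpos hG (X ω)
    exact (hω g hg).trans h
  have hint : ∫ ω, e ω ∂μ = ∫ ω, ψ ω ∂μ - ∫ ω, cost (X ω) (Y ω) ∂μ := by
    rw [he, integral_condExp hm, integral_sub hψ hc]
  refine ⟨by linarith [integral_nonpos_of_ae (μ := μ) (f := e) hneg], fun heq => ?_⟩
  have hie : Integrable e μ := integrable_condExp
  have he0 : ∀ᵐ ω ∂μ, e ω = 0 := by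
    have := (integral_eq_zero_iff_of_nonneg_ae (μ := μ) (f := fun ω => - e ω)
      (by filter_upwards [hneg] with ω hω; simpa using hω) hie.neg).1
      (by rw [integral_neg, hint]; linarith)
    filter_upwards [this] with ω hω
    simpa using hω
  -- With e = 0 the bound `key'` reads c(g, X) ≥ 0 on G, so maximality applies.
  have hmem : ∀ᵐ ω ∂μ, X ω ∈ G := by
    filter_upwards [key', he0] with ω h3 h4
    exact mem_of_forall_cost_nonneg hG fun g hg => h4 ▸ h3 g hg
  have hψc : ∀ᵐ ω ∂μ, ψ ω ≤ cost (X ω) (Y ω) := by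
    filter_upwards [hmem, hle] with ω h3 h4 using h4 _ h3
  have := (integral_eq_zero_iff_of_nonneg_ae (μ := μ) (f := fun ω => cost (X ω) (Y ω) - ψ ω)
    (by filter_upwards [hψc] with ω hω; simpa using hω) (hc.sub hψ)).1
    (by rw [integral_sub hc hψ]; linarith)
  filter_upwards [this, hmem] with ω h3 h4
  have h5 : cost (X ω) (Y ω) - ψ ω = 0 := h3
  exact ⟨by linarith, h4⟩

end Integrability

/-! ### Construction of maximal monotone sets -/

/-- The completed graph of an increasing extended-real function. -/
def completedGraph (L : ℝ → EReal) : Set (ℝ × ℝ) :=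
  {z | (∀ q < z.1, L q ≤ (z.2 : EReal)) ∧ ∀ q > z.1, (z.2 : EReal) ≤ L q}

/-- An increasing L crosses every descending line q ↦ p - q. The values at a and b keep the crossing
abscissa, the supremum of the points where L is below the line, finite. -/
lemma exists_mem_completedGraph {L : ℝ → EReal} (hL : Monotone L) {a b : ℝ} (ha : L a ≠ ⊤)
    (hb : L b ≠ ⊥) (p : ℝ) : ∃ z ∈ completedGraph L, z.1 + z.2 = p := by
  set A : Set ℝ := {q | L q < ((p - q : ℝ) : EReal)} with hA
  have hdown : ∀ q ∈ A, ∀ q' ≤ q, q' ∈ A := fun q hq q' h =>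
    ((hL h).trans_lt hq).trans_le (EReal.coe_le_coe_iff.2 (by linarith))
  have hne : A.Nonempty := by
    obtain ⟨t, ht, -⟩ := EReal.lt_iff_exists_real_btwn.1 (lt_top_iff_ne_top.2 ha)
    refine ⟨min a (p - t), ((hL (min_le_left _ _)).trans_lt ht).trans_le ?_⟩
    exact EReal.coe_le_coe_iff.2 (by linarith [min_le_right a (p - t)])
  have hbdd : BddAbove A := by
    obtain ⟨t, -, ht⟩ := EReal.lt_iff_exists_real_btwn.1 (bot_lt_iff_ne_bot.2 hb)
    refine ⟨max b (p - t), fun q hq => ?_⟩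
    by_contra! hlt
    have h1 : (t : EReal) < ((p - q : ℝ) : EReal) :=
      (ht.trans_le (hL ((le_max_left _ _).trans hlt.le))).trans hq
    have := EReal.coe_lt_coe_iff.1 h1
    linarith [le_max_right b (p - t)]
  refine ⟨(sSup A, p - sSup A), ⟨fun q hq => ?_, fun q hq => ?_⟩, by simp⟩
  · by_contra! h
    obtain ⟨t, ht, ht'⟩ := EReal.lt_iff_exists_real_btwn.1 h
    have ht := EReal.coe_lt_coe_iff.1 ht
    simp only at hq ht
    obtain ⟨q', hq', hlt⟩ := exists_lt_of_lt_csSup hne (max_lt hq (by linarith : p - t < sSup A))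
    have h1 : (t : EReal) < ((p - q' : ℝ) : EReal) :=
      (ht'.trans_le (hL ((le_max_left _ _).trans hlt.le))).trans hq'
    have := EReal.coe_lt_coe_iff.1 h1
    linarith [le_max_right q (p - t)]
  · by_contra! h
    obtain ⟨t, ht, ht'⟩ := EReal.lt_iff_exists_real_btwn.1 h
    have ht' := EReal.coe_lt_coe_iff.1 ht'
    simp only at hq ht'
    obtain ⟨q', h1, h2⟩ := exists_between (lt_min hq (by linarith : sSup A < p - t))
    have : q' ∈ A := ((hL (h2.le.trans (min_le_left _ _))).trans_lt ht).trans_le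
      (EReal.coe_le_coe_iff.2 (by linarith [min_le_right q (p - t)]))
    exact absurd (le_csSup hbdd this) (not_le.2 h1)

lemma isMaximalMonotone_completedGraph {L : ℝ → EReal} (hL : Monotone L) {a b : ℝ}
    (ha : L a ≠ ⊤) (hb : L b ≠ ⊥) : IsMaximalMonotone (completedGraph L) := by
  have hord : ∀ r ∈ completedGraph L, ∀ s ∈ completedGraph L, r.1 < s.1 → r.2 ≤ s.2 := by
    intro r hr s hs h
    obtain ⟨q, h1, h2⟩ := exists_between h
    exact EReal.coe_le_coe_iff.1 ((hr.2 q h1).trans (hs.1 q h2))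
  refine ⟨fun r hr s hs => ?_, fun H hH hsub x hx => ?_⟩
  · rcases lt_trichotomy r.1 s.1 with h | h | h
    · exact mul_nonneg_of_nonpos_of_nonpos (by linarith) (by linarith [hord r hr s hs h])
    · simp [cost, h]
    · exact mul_nonneg (by linarith) (by linarith [hord s hs r hr h])
  -- Minty's argument: on an antidiagonal c(x, z) is minus a square, so only x = z is compatible
  -- with monotonicity.
  · obtain ⟨z, hz, hp⟩ := exists_mem_completedGraph hL ha hb (x.1 + x.2)
    have h := hH x hx z (hsub hz)
    have h1 : cost x z = -(x.1 - z.1) ^ 2 := by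
      simp only [cost]
      rw [show x.2 - z.2 = -(x.1 - z.1) by linarith]; ring
    have h2 : x.1 - z.1 = 0 := by
      have : (x.1 - z.1) ^ 2 ≤ 0 := by linarith
      exact pow_eq_zero_iff two_ne_zero |>.1 (le_antisymm this (sq_nonneg _))
    have : x = z := Prod.ext (by linarith) (by linarith)
    exact this ▸ hz

/-- Given profit bounds `k` at points `y` which are compatible in pairs, there is a maximal monotone
set on which `c(·, y) ≥ -k` for all of them. -/
theorem exists_maximalMonotone_of_pairwise {T : Set ((ℝ × ℝ) × ℝ)} (hne : T.Nonempty)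
    (hk : ∀ a ∈ T, 0 ≤ a.2)
    (hpair : ∀ a ∈ T, ∀ b ∈ T, ∀ r, a.1.1 < r → r < b.1.1 →
      a.1.2 - a.2 / (r - a.1.1) ≤ b.1.2 + b.2 / (b.1.1 - r)) :
    ∃ G, IsMaximalMonotone G ∧ ∀ a ∈ T, ∀ g ∈ G, -a.2 ≤ cost g a.1 := by
  -- L is the supremum of the lower barriers, each of which increases in r because k ≥ 0; `hpair`
  -- keeps L below the upper barriers.
  set L : ℝ → EReal := fun r =>
    ⨆ a ∈ {a ∈ T | a.1.1 < r}, ((a.1.2 - a.2 / (r - a.1.1) : ℝ) : EReal) with hLdef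
  have hlow : ∀ a ∈ T, ∀ r, a.1.1 < r → ((a.1.2 - a.2 / (r - a.1.1) : ℝ) : EReal) ≤ L r :=
    fun a ha r hr => le_iSup₂_of_le a ⟨ha, hr⟩ le_rfl
  have hup : ∀ b ∈ T, ∀ r, r < b.1.1 → L r ≤ ((b.1.2 + b.2 / (b.1.1 - r) : ℝ) : EReal) :=
    fun b hb r hr => iSup₂_le fun a ha => EReal.coe_le_coe_iff.2 (hpair a ha.1 b hb r ha.2 hr)
  have hL : Monotone L := by
    refine fun r r' h => iSup₂_le fun a ha => ?_
    have hr : a.1.1 < r := ha.2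
    refine le_trans (EReal.coe_le_coe_iff.2 ?_) (hlow a ha.1 r' (hr.trans_le h))
    have : a.2 / (r' - a.1.1) ≤ a.2 / (r - a.1.1) :=
      div_le_div_of_nonneg_left (hk a ha.1) (by linarith) (by linarith)
    linarith
  obtain ⟨a₀, ha₀⟩ := hne
  refine ⟨completedGraph L, isMaximalMonotone_completedGraph hL (a := a₀.1.1 - 1)
    (b := a₀.1.1 + 1) ?_ ?_, fun a ha g hg => ?_⟩
  · exact ((hup a₀ ha₀ _ (by linarith)).trans_lt (EReal.coe_lt_top _)).ne
  · exact ((EReal.bot_lt_coe _).trans_le (hlow a₀ ha₀ _ (by linarith))).ne'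
  · rcases lt_trichotomy g.1 a.1.1 with h | h | h
    -- The completed graph is compared with L only at abscissae other than g.1, so the bound is
    -- obtained at q and then q → g.1.
    · have hq : ∀ q, g.1 < q → q < a.1.1 → (g.2 - a.1.2) * (a.1.1 - q) ≤ a.2 := by
        intro q h1 h2
        have := EReal.coe_le_coe_iff.1 ((hg.2 q h1).trans (hup a ha q h2))
        rw [← le_div_iff₀ (by linarith)]; linarith
      have hlim := le_of_tendsto (f := fun q => (g.2 - a.1.2) * (a.1.1 - q))
        (x := nhdsWithin g.1 (Set.Ioi g.1)) (a := (g.2 - a.1.2) * (a.1.1 - g.1)) (b := a.2)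
        ((Continuous.tendsto (by fun_prop) _).mono_left nhdsWithin_le_nhds)
        (by filter_upwards [Ioo_mem_nhdsGT h] with q hq' using hq q hq'.1 hq'.2)
      simp only [cost]; linarith
    · simp [cost, h, hk a ha]
    · have hq : ∀ q, a.1.1 < q → q < g.1 → (a.1.2 - g.2) * (q - a.1.1) ≤ a.2 := by
        intro q h1 h2
        have := EReal.coe_le_coe_iff.1 ((hlow a ha q h1).trans (hg.1 q h2))
        rw [← le_div_iff₀ (by linarith)]; linarith
      have hlim := le_of_tendsto (f := fun q => (a.1.2 - g.2) * (q - a.1.1))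
        (x := nhdsWithin g.1 (Set.Iio g.1)) (a := (a.1.2 - g.2) * (g.1 - a.1.1)) (b := a.2)
        ((Continuous.tendsto (by fun_prop) _).mono_left nhdsWithin_le_nhds)
        (by filter_upwards [Ioo_mem_nhdsLT h] with q hq' using hq q hq'.1 hq'.2)
      simp only [cost]; linarith

/-! ### The function φ_G and the martingale property by set integrals -/

lemma phi_le_cost {G : Set (ℝ × ℝ)} {g : ℝ × ℝ} (hg : g ∈ G) (y : ℝ × ℝ) :
    phi G y ≤ (cost g y : EReal) := iInf₂_le g hg

lemma le_phi {G : Set (ℝ × ℝ)} {y : ℝ × ℝ} {a : ℝ} (h : ∀ g ∈ G, a ≤ cost g y) :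
    (a : EReal) ≤ phi G y := le_iInf₂ fun g hg => EReal.coe_le_coe_iff.2 (h g hg)

lemma phi_nonpos {G : Set (ℝ × ℝ)} (hG : IsMaximalMonotone G) (y : ℝ × ℝ) : phi G y ≤ 0 := by
  obtain ⟨g, hg, h⟩ := exists_cost_nonpos hG y
  exact (phi_le_cost hg y).trans (by exact_mod_cast h)

/-- An infimum of continuous functions is upper semicontinuous, even over an uncountable G. -/
lemma measurable_phi (G : Set (ℝ × ℝ)) : Measurable (phi G) := by
  refine UpperSemicontinuous.measurable (upperSemicontinuous_biInf fun g _ => ?_)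
  refine Continuous.upperSemicontinuous (continuous_coe_real_ereal.comp ?_)
  unfold cost; fun_prop

lemma condExp_comap_eq {α β : Type*} {m0 : MeasurableSpace α} [mβ : MeasurableSpace β]
    {μ : Measure α} [IsFiniteMeasure μ] {T : α → β} (hT : Measurable T) {u w : α → ℝ}
    (hu : Integrable u μ) (hw : Integrable w μ) (hwm : Measurable[mβ.comap T] w)
    (h : ∀ s, MeasurableSet s → ∫ ω in T ⁻¹' s, w ω ∂μ = ∫ ω in T ⁻¹' s, u ω ∂μ) :
    μ[u | mβ.comap T] =ᵐ[μ] w := by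
  refine (ae_eq_condExp_of_forall_setIntegral_eq hT.comap_le hu (fun s _ _ => hw.integrableOn)
    ?_ hwm.stronglyMeasurable.aestronglyMeasurable).symm
  rintro _ ⟨s, hs, rfl⟩ _
  exact h s hs

lemma isPlan_of_setIntegral {ν : Measure (ℝ × ℝ)} {γ : Measure ((ℝ × ℝ) × (ℝ × ℝ))}
    [IsProbabilityMeasure γ] (h2 : MemLp id 2 γ) (hν : γ.map Prod.snd = ν)
    (h : ∀ s, MeasurableSet s →
      ∫ z in Prod.fst ⁻¹' s, z.1.1 ∂γ = ∫ z in Prod.fst ⁻¹' s, z.2.1 ∂γ ∧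
      ∫ z in Prod.fst ⁻¹' s, z.1.2 ∂γ = ∫ z in Prod.fst ⁻¹' s, z.2.2 ∂γ) :
    IsPlan ν γ := by
  have hfst : Measurable[MeasurableSpace.comap (Prod.fst : (ℝ × ℝ) × (ℝ × ℝ) → ℝ × ℝ) inferInstance]
      (Prod.fst : (ℝ × ℝ) × (ℝ × ℝ) → ℝ × ℝ) := comap_measurable _
  exact ⟨inferInstance, h2, hν,
    condExp_comap_eq measurable_fst (h2.snd.fst.integrable one_le_two)
      (h2.fst.fst.integrable one_le_two) (measurable_fst.comp hfst) fun s hs => (h s hs).1,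
    condExp_comap_eq measurable_fst (h2.snd.snd.integrable one_le_two)
      (h2.fst.snd.integrable one_le_two) (measurable_snd.comp hfst) fun s hs => (h s hs).2⟩

/-! ### Duality for plans -/

section Plans

variable {ν : Measure (ℝ × ℝ)} {γ : Measure ((ℝ × ℝ) × (ℝ × ℝ))}

lemma dualValue_eq_of_isPlan (hγ : IsPlan ν γ) (G : Set (ℝ × ℝ)) :
    dualValue ν G = -((∫⁻ z, (-phi G z.2).toENNReal ∂γ : ENNReal) : EReal) := by
  rw [dualValue, ← hγ.marginal, lintegral_map (by
    exact (measurable_phi G).neg.ereal_toENNReal) measurable_snd]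

/-- Weak duality for a plan and a maximal monotone set, with the case of equality. -/
theorem IsPlan.duality (hγ : IsPlan ν γ) {G : Set (ℝ × ℝ)} (hG : IsMaximalMonotone G) :
    dualValue ν G ≤ ((∫ z, cost z.1 z.2 ∂γ : ℝ) : EReal) ∧
      (dualValue ν G = ((∫ z, cost z.1 z.2 ∂γ : ℝ) : EReal) →
        ∀ᵐ z ∂γ, phi G z.2 = (cost z.1 z.2 : EReal) ∧ z.1 ∈ G) := by
  have := hγ.isProb
  rw [dualValue_eq_of_isPlan hγ]
  have hmeas : Measurable fun z : (ℝ × ℝ) × (ℝ × ℝ) => (-phi G z.2).toENNReal :=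
    ((measurable_phi G).comp measurable_snd).neg.ereal_toENNReal
  set J := ∫⁻ z, (-phi G z.2).toENNReal ∂γ with hJ
  -- If J is infinite, the dual value is ⊥: the inequality is trivial and equality impossible.
  rcases eq_or_ne J ⊤ with htop | htop
  · rw [htop]
    simp
  set ψ : (ℝ × ℝ) × (ℝ × ℝ) → ℝ := fun z => -((-phi G z.2).toENNReal).toReal with hψ
  have hψi : Integrable ψ γ := (integrable_toReal_of_lintegral_ne_top hmeas.aemeasurable htop).neg
  have hψphi : ∀ᵐ z ∂γ, (ψ z : EReal) = phi G z.2 := by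
    filter_upwards [ae_lt_top hmeas htop] with z hz
    have h0 : 0 ≤ -phi G z.2 := by simpa using phi_nonpos hG z.2
    rw [hψ]
    simp only [EReal.coe_neg, EReal.coe_ennreal_toReal hz.ne, EReal.coe_toENNReal h0, neg_neg]
  have hψint : ((∫ z, ψ z ∂γ : ℝ) : EReal) = -(J : EReal) := by
    rw [hψ, integral_neg, integral_toReal hmeas.aemeasurable (ae_lt_top hmeas htop), ← hJ,
      EReal.coe_neg, EReal.coe_ennreal_toReal htop]
  have hfst : Measurable[MeasurableSpace.comap (Prod.fst : (ℝ × ℝ) × (ℝ × ℝ) → ℝ × ℝ) inferInstance]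
      (Prod.fst : (ℝ × ℝ) × (ℝ × ℝ) → ℝ × ℝ) := comap_measurable _
  have hwd := weak_duality measurable_fst.comap_le hfst hγ.memLp.fst hγ.memLp.snd
    hγ.martingale_fst hγ.martingale_snd hG hψi (by
      filter_upwards [hψphi] with z hz g hg
      exact EReal.coe_le_coe_iff.1 (hz ▸ phi_le_cost hg _))
  rw [← hψint]
  refine ⟨EReal.coe_le_coe_iff.2 hwd.1, fun h => ?_⟩
  filter_upwards [hwd.2 (EReal.coe_eq_coe_iff.1 h), hψphi] with z h1 h2
  exact ⟨by rw [← h2, h1.1]; rfl, h1.2⟩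

/-- One inequality is weak duality. The other integrates c ≤ φ_G ≤ 0, where the sign identifies the
Bochner integral of -c with its Lebesgue integral. -/
lemma IsPlan.dualValue_eq (hγ : IsPlan ν γ) {G : Set (ℝ × ℝ)} (hG : IsMaximalMonotone G)
    (h : ∀ᵐ z ∂γ, ∀ g ∈ G, cost z.1 z.2 ≤ cost g z.2) :
    dualValue ν G = ((∫ z, cost z.1 z.2 ∂γ : ℝ) : EReal) := by
  have := hγ.isProb
  refine le_antisymm (hγ.duality hG).1 ?_
  have hi : Integrable (fun z : (ℝ × ℝ) × (ℝ × ℝ) => cost z.1 z.2) γ :=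
    integrable_cost hγ.memLp.fst hγ.memLp.snd
  have hphi : ∀ᵐ z ∂γ, (cost z.1 z.2 : EReal) ≤ phi G z.2 := by
    filter_upwards [h] with z hz using le_phi hz
  have hneg : ∀ᵐ z ∂γ, 0 ≤ -cost z.1 z.2 := by
    filter_upwards [hphi] with z hz
    have : (cost z.1 z.2 : EReal) ≤ 0 := hz.trans (phi_nonpos hG z.2)
    have : cost z.1 z.2 ≤ 0 := by exact_mod_cast this
    linarith
  rw [dualValue_eq_of_isPlan hγ, EReal.le_neg]
  have h1 : ∫⁻ z, (-phi G z.2).toENNReal ∂γ ≤ ∫⁻ z, ENNReal.ofReal (-cost z.1 z.2) ∂γ := by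
    refine lintegral_mono_ae ?_
    filter_upwards [hphi] with z hz
    rw [show ENNReal.ofReal (-cost z.1 z.2) = ((-cost z.1 z.2 : ℝ) : EReal).toENNReal by
      rw [EReal.toENNReal_of_ne_top (by simp), EReal.toReal_coe]]
    exact EReal.toENNReal_le_toENNReal (by rw [EReal.coe_neg]; exact EReal.neg_le_neg_iff.2 hz)
  rw [← ofReal_integral_eq_lintegral_ofReal (f := fun z : (ℝ × ℝ) × (ℝ × ℝ) => -cost z.1 z.2) hi.neg hneg] at h1
  refine (EReal.coe_ennreal_le_coe_ennreal_iff.2 h1).trans ?_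
  rw [EReal.coe_ennreal_ofReal, max_eq_left (integral_nonneg_of_ae hneg)]
  simp [integral_neg]

lemma IsPlan.optimal_of_dualValue_eq (hγ : IsPlan ν γ) {G : Set (ℝ × ℝ)}
    (hG : IsMaximalMonotone G)
    (h : dualValue ν G = ((∫ z, cost z.1 z.2 ∂γ : ℝ) : EReal)) :
    IsOptimalPlan ν γ ∧ IsDualMaximizer ν G :=
  ⟨⟨hγ, fun _ hγ' => EReal.coe_le_coe_iff.1 (h ▸ (hγ'.duality hG).1)⟩,
    hG, fun _ hG' => h ▸ (hγ.duality hG').1⟩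

end Plans

/-! ### From maps to plans -/

section Maps

variable {Ω : Type*} [MeasurableSpace Ω] {P : Measure Ω} {X Y : Ω → ℝ × ℝ}

lemma IsMap.measurable_map (hX : IsMap P Y X) (hY : Measurable Y) : Measurable X :=
  hX.measurable.mono hY.comap_le le_rfl

lemma integral_cost_map (hX : Measurable X) (hY : Measurable Y) :
    ∫ z, cost z.1 z.2 ∂(P.map fun ω => (X ω, Y ω)) = ∫ ω, cost (X ω) (Y ω) ∂P :=
  integral_map (hX.prodMk hY).aemeasurable measurable_cost.aestronglyMeasurable

lemma IsMap.isPlan [IsProbabilityMeasure P] (hX : IsMap P Y X) (hY : Measurable Y) (hY2 : MemLp Y 2 P) :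
    IsPlan (P.map Y) (P.map fun ω => (X ω, Y ω)) := by
  have mX := hX.measurable_map hY
  have mXY : Measurable fun ω => (X ω, Y ω) := mX.prodMk hY
  have : IsProbabilityMeasure (P.map fun ω => (X ω, Y ω)) :=
    Measure.isProbabilityMeasure_map mXY.aemeasurable
  refine isPlan_of_setIntegral ?_ ?_ fun s hs => ?_
  · rw [memLp_map_measure_iff aestronglyMeasurable_id mXY.aemeasurable]
    exact memLp_prod_iff.2 ⟨hX.memLp, hY2⟩
  · rw [Measure.map_map measurable_snd mXY]; rfl
  · have hs' : MeasurableSet ((Prod.fst : (ℝ × ℝ) × (ℝ × ℝ) → ℝ × ℝ) ⁻¹' s) := measurable_fst hs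
    have hcomap : MeasurableSet[MeasurableSpace.comap X inferInstance] (X ⁻¹' s) := ⟨s, hs, rfl⟩
    rw [setIntegral_map hs' (by fun_prop) mXY.aemeasurable,
      setIntegral_map hs' (by fun_prop) mXY.aemeasurable,
      setIntegral_map hs' (by fun_prop) mXY.aemeasurable,
      setIntegral_map hs' (by fun_prop) mXY.aemeasurable]
    constructor
    · refine Eq.trans ?_ (setIntegral_condExp mX.comap_le (hY2.fst.integrable one_le_two) hcomap)
      exact setIntegral_congr_ae (mX hs)
        (by filter_upwards [hX.martingale_fst] with z hz _ using hz.symm)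
    · refine Eq.trans ?_ (setIntegral_condExp mX.comap_le (hY2.snd.integrable one_le_two) hcomap)
      exact setIntegral_congr_ae (mX hs)
        (by filter_upwards [hX.martingale_snd] with z hz _ using hz.symm)

/-- Tower property: conditioning on an m larger than σ(X) suffices. Below, m is generated by the
total order alone. -/
lemma isMap_of_condExp {Ω : Type*} {m : MeasurableSpace Ω} [MeasurableSpace Ω] {P : Measure Ω}
    [IsProbabilityMeasure P] {X Y : Ω → ℝ × ℝ} (hY : Measurable Y)
    (hm : m ≤ MeasurableSpace.comap Y inferInstance) (hX : Measurable[m] X)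
    (hX2 : MemLp X 2 P)
    (h1 : P[fun ω => (Y ω).1 | m] =ᵐ[P] fun ω => (X ω).1)
    (h2 : P[fun ω => (Y ω).2 | m] =ᵐ[P] fun ω => (X ω).2) : IsMap P Y X := by
  have hm0 := hm.trans hY.comap_le
  have hle : MeasurableSpace.comap X inferInstance ≤ m := hX.comap_le
  have hXc : Measurable[MeasurableSpace.comap X inferInstance] X := comap_measurable X
  refine ⟨hX2, hX.mono hm le_rfl, ?_, ?_⟩
  · refine (condExp_condExp_of_le hle hm0).symm.trans ((condExp_congr_ae h1).trans ?_)
    exact .of_eq (condExp_of_stronglyMeasurable (hle.trans hm0)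
      (measurable_fst.comp hXc).stronglyMeasurable (hX2.fst.integrable one_le_two))
  · refine (condExp_condExp_of_le hle hm0).symm.trans ((condExp_congr_ae h2).trans ?_)
    exact .of_eq (condExp_of_stronglyMeasurable (hle.trans hm0)
      (measurable_snd.comp hXc).stronglyMeasurable (hX2.snd.integrable one_le_two))

lemma IsMap.isOptimalMap_of_plan [IsProbabilityMeasure P] (hX : IsMap P Y X) (hY : Measurable Y) (hY2 : MemLp Y 2 P)
    (h : IsOptimalPlan (P.map Y) (P.map fun ω => (X ω, Y ω))) : IsOptimalMap P Y X := by
  refine ⟨hX, fun X' hX' => ?_⟩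
  have := h.2 _ (hX'.isPlan hY hY2)
  rwa [integral_cost_map (hX.measurable_map hY) hY,
    integral_cost_map (hX'.measurable_map hY) hY] at this

/-- The condition is closed, being an intersection of closed ones, so it is measurable although G is
uncountable. -/
lemma ae_map_le_cost (hX : Measurable X) (hY : Measurable Y) {G : Set (ℝ × ℝ)}
    (h : ∀ᵐ ω ∂P, ∀ g ∈ G, cost (X ω) (Y ω) ≤ cost g (Y ω)) :
    ∀ᵐ z ∂(P.map fun ω => (X ω, Y ω)), ∀ g ∈ G, cost z.1 z.2 ≤ cost g z.2 := by
  rw [ae_map_iff (hX.prodMk hY).aemeasurable]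
  · exact h
  · simp only [Set.ofPred_forall]
    refine (isClosed_biInter fun g _ => ?_).measurableSet
    exact isClosed_le continuous_cost (by unfold cost; fun_prop)

end Maps

/-! ### Competing plans and the first-order condition -/

section Mixtures

variable {γ : Measure ((ℝ × ℝ) × (ℝ × ℝ))} {w : (ℝ × ℝ) × (ℝ × ℝ) → ℝ}
  {X : (ℝ × ℝ) × (ℝ × ℝ) → ℝ × ℝ}

/-- The part of `γ` with density `w`, transported in the first variable by `X`. -/
noncomputable def transported (γ : Measure ((ℝ × ℝ) × (ℝ × ℝ))) (w : (ℝ × ℝ) × (ℝ × ℝ) → ℝ)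
    (X : (ℝ × ℝ) × (ℝ × ℝ) → ℝ × ℝ) : Measure ((ℝ × ℝ) × (ℝ × ℝ)) :=
  (γ.withDensity fun z => ENNReal.ofReal (w z)).map fun z => (X z, z.2)

lemma integral_transported (hw : Measurable w) (hw0 : ∀ z, 0 ≤ w z) (hX : Measurable X)
    {f : (ℝ × ℝ) × (ℝ × ℝ) → ℝ} (hf : Measurable f) :
    ∫ z, f z ∂(transported γ w X) = ∫ z, w z * f (X z, z.2) ∂γ := by
  rw [transported, integral_map (by fun_prop) hf.aestronglyMeasurable,
    integral_withDensity_eq_integral_toReal_smul (by fun_prop) (by simp)]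
  simp [ENNReal.toReal_ofReal, hw0]

lemma setIntegral_transported (hw : Measurable w) (hw0 : ∀ z, 0 ≤ w z) (hX : Measurable X)
    {f : (ℝ × ℝ) × (ℝ × ℝ) → ℝ} (hf : Measurable f) {s : Set (ℝ × ℝ)} (hs : MeasurableSet s) :
    ∫ z in Prod.fst ⁻¹' s, f z ∂(transported γ w X) = ∫ z in X ⁻¹' s, w z * f (X z, z.2) ∂γ := by
  rw [transported, setIntegral_map (measurable_fst hs) hf.aestronglyMeasurable (by fun_prop)]
  change ∫ z in X ⁻¹' s, f (X z, z.2) ∂(γ.withDensity fun z => ENNReal.ofReal (w z)) = _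
  rw [setIntegral_withDensity_eq_setIntegral_toReal_smul (by fun_prop) (by simp) _ (hX hs)]
  simp [ENNReal.toReal_ofReal, hw0]

lemma memLp_transported (hw1 : ∀ z, w z ≤ 1) (hX : Measurable X)
    (hX2 : MemLp X 2 γ) (hγ : MemLp (fun z => z.2) 2 γ) : MemLp id 2 (transported γ w X) := by
  rw [transported, memLp_map_measure_iff aestronglyMeasurable_id (by fun_prop)]
  refine MemLp.mono_measure (μ := γ) ?_ (memLp_prod_iff.2 ⟨hX2, hγ⟩)
  calc γ.withDensity (fun z => ENNReal.ofReal (w z)) ≤ γ.withDensity 1 :=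
        withDensity_mono (ae_of_all _ fun z => by simpa using hw1 z)
    _ = γ := withDensity_one

lemma map_snd_transported (hX : Measurable X) :
    (transported γ w X).map Prod.snd
      = (γ.withDensity fun z => ENNReal.ofReal (w z)).map Prod.snd := by
  rw [transported, Measure.map_map measurable_snd (by fun_prop)]
  rfl

lemma memLp_two_add_measure {μ μ' : Measure ((ℝ × ℝ) × (ℝ × ℝ))} (h : MemLp id 2 μ)
    (h' : MemLp id 2 μ') : MemLp id 2 (μ + μ') := by
  rw [memLp_two_iff_integrable_sq_norm aestronglyMeasurable_id] at *
  exact h.add_measure h'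

variable {ν : Measure (ℝ × ℝ)} {X' : (ℝ × ℝ) × (ℝ × ℝ) → ℝ × ℝ}

/-- The barycenter condition is linear in the plan: if both parts are centered at their images, so
is the sum, even where the images overlap. -/
lemma isPlan_transported_add (hγ : IsPlan ν γ) (hw : Measurable w) (hw0 : ∀ z, 0 ≤ w z)
    (hw1 : ∀ z, w z ≤ 1) (hX : Measurable X) (hX' : Measurable X') (hX2 : MemLp X 2 γ)
    (hX2' : MemLp X' 2 γ)
    (h : ∀ s, MeasurableSet s →
      ∫ z in X ⁻¹' s, (1 - w z) * (X z).1 ∂γ = ∫ z in X ⁻¹' s, (1 - w z) * z.2.1 ∂γ ∧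
      ∫ z in X ⁻¹' s, (1 - w z) * (X z).2 ∂γ = ∫ z in X ⁻¹' s, (1 - w z) * z.2.2 ∂γ)
    (h' : ∀ s, MeasurableSet s →
      ∫ z in X' ⁻¹' s, w z * (X' z).1 ∂γ = ∫ z in X' ⁻¹' s, w z * z.2.1 ∂γ ∧
      ∫ z in X' ⁻¹' s, w z * (X' z).2 ∂γ = ∫ z in X' ⁻¹' s, w z * z.2.2 ∂γ) :
    IsPlan ν (transported γ (fun z => 1 - w z) X + transported γ w X') ∧
    ∫ z, cost z.1 z.2 ∂(transported γ (fun z => 1 - w z) X + transported γ w X') =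
      ∫ z, (1 - w z) * cost (X z) z.2 ∂γ + ∫ z, w z * cost (X' z) z.2 ∂γ := by
  have := hγ.isProb
  have hv : Measurable fun z => 1 - w z := hw.const_sub 1
  have hv0 : ∀ z, 0 ≤ 1 - w z := fun z => by linarith [hw1 z]
  have hv1 : ∀ z, 1 - w z ≤ 1 := fun z => by linarith [hw0 z]
  have m1 := memLp_transported hv1 hX hX2 hγ.memLp.snd
  have m2 := memLp_transported hw1 hX' hX2' hγ.memLp.snd
  have hsum : (transported γ (fun z => 1 - w z) X + transported γ w X').map Prod.snd = ν := by
    rw [Measure.map_add _ _ measurable_snd, map_snd_transported hX, map_snd_transported hX',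
      ← Measure.map_add _ _ measurable_snd, ← withDensity_add_left (by fun_prop)]
    have : ((fun z => ENNReal.ofReal (1 - w z)) + fun z => ENNReal.ofReal (w z))
        = (1 : (ℝ × ℝ) × (ℝ × ℝ) → ENNReal) := by
      ext z
      simp [← ENNReal.ofReal_add (hv0 z) (hw0 z)]
    rw [this, withDensity_one, hγ.marginal]
  have hprob : IsProbabilityMeasure
      (transported γ (fun z => 1 - w z) X + transported γ w X') := by
    have hν : IsProbabilityMeasure ν :=
      hγ.marginal ▸ Measure.isProbabilityMeasure_map measurable_snd.aemeasurable
    constructor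
    have h1 : ν Set.univ = 1 := measure_univ
    rw [← hsum, Measure.map_apply measurable_snd MeasurableSet.univ] at h1
    simpa using h1
  have f1 : IsFiniteMeasure (transported γ (fun z => 1 - w z) X) :=
    isFiniteMeasure_of_le (transported γ (fun z => 1 - w z) X + transported γ w X')
      (Measure.le_add_right le_rfl)
  have f2 : IsFiniteMeasure (transported γ w X') :=
    isFiniteMeasure_of_le (transported γ (fun z => 1 - w z) X + transported γ w X')
      (Measure.le_add_left le_rfl)
  have c1 : Integrable (fun z => cost z.1 z.2) (transported γ (fun z => 1 - w z) X) :=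
    integrable_cost m1.fst m1.snd
  have c2 : Integrable (fun z => cost z.1 z.2) (transported γ w X') :=
    integrable_cost m2.fst m2.snd
  refine ⟨isPlan_of_setIntegral (memLp_two_add_measure m1 m2) hsum fun s hs => ?_, ?_⟩
  · have split : ∀ f : (ℝ × ℝ) × (ℝ × ℝ) → ℝ, Measurable f →
        Integrable f (transported γ (fun z => 1 - w z) X) → Integrable f (transported γ w X') →
        ∫ z in Prod.fst ⁻¹' s, f z ∂(transported γ (fun z => 1 - w z) X + transported γ w X')
          = ∫ z in X ⁻¹' s, (1 - w z) * f (X z, z.2) ∂γ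
            + ∫ z in X' ⁻¹' s, w z * f (X' z, z.2) ∂γ := by
      intro f hf i1 i2
      rw [Measure.restrict_add, integral_add_measure i1.restrict i2.restrict,
        setIntegral_transported hv hv0 hX hf hs, setIntegral_transported hw hw0 hX' hf hs]
    rw [split (fun z => z.1.1) (by fun_prop) (m1.fst.fst.integrable one_le_two)
        (m2.fst.fst.integrable one_le_two),
      split (fun z => z.2.1) (by fun_prop) (m1.snd.fst.integrable one_le_two)
        (m2.snd.fst.integrable one_le_two),
      split (fun z => z.1.2) (by fun_prop) (m1.fst.snd.integrable one_le_two)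
        (m2.fst.snd.integrable one_le_two),
      split (fun z => z.2.2) (by fun_prop) (m1.snd.snd.integrable one_le_two)
        (m2.snd.snd.integrable one_le_two)]
    exact ⟨by rw [(h s hs).1, (h' s hs).1], by rw [(h s hs).2, (h' s hs).2]⟩
  · rw [integral_add_measure c1 c2,
      integral_transported hv hv0 hX measurable_cost,
      integral_transported hw hw0 hX' measurable_cost]

end Mixtures

/-- Reweighting by the density `1 - ε h` shifts a conditional mean by an `m`-measurable amount
of order `ε`. -/
lemma exists_recentering {α : Type*} {m m0 : MeasurableSpace α} {μ : Measure α}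
    [IsProbabilityMeasure μ] (hm : m ≤ m0) {h u : α → ℝ}
    (hh : Measurable h) (h0 : ∀ ω, 0 ≤ h ω) (h1 : ∀ ω, h ω ≤ 1) (hu : Integrable u μ)
    (hu0 : μ[u | m] =ᵐ[μ] 0) {C : ℝ} (hC : ∀ ω, |h ω * u ω| ≤ C) {ε : ℝ} (hε : 0 < ε)
    (hε' : ε ≤ 1 / 2) :
    ∃ d : α → ℝ, Measurable[m] d ∧ (∀ᵐ ω ∂μ, |d ω| ≤ 2 * ε * C) ∧
      μ[fun ω => (1 - ε * h ω) * (u ω - d ω) | m] =ᵐ[μ] 0 := by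
  set ρ := μ[h | m] with hρ
  set η := μ[fun ω => h ω * u ω | m] with hη
  have ih : Integrable h μ := Integrable.of_bound hh.aestronglyMeasurable 1
    (ae_of_all _ fun ω => by rw [Real.norm_eq_abs, abs_of_nonneg (h0 ω)]; exact h1 ω)
  have ihu : Integrable (fun ω => h ω * u ω) μ := hu.bdd_mul hh.aestronglyMeasurable
    (ae_of_all _ fun ω => by rw [Real.norm_eq_abs, abs_of_nonneg (h0 ω)]; exact h1 ω)
  have hρ0 : ∀ᵐ ω ∂μ, 0 ≤ ρ ω := condExp_nonneg (ae_of_all _ h0)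
  have hρ1 : ∀ᵐ ω ∂μ, ρ ω ≤ 1 := by
    have := condExp_mono (m := m) ih (integrable_const (1 : ℝ)) (ae_of_all μ h1)
    rw [condExp_const hm] at this
    exact this
  have hηC : ∀ᵐ ω ∂μ, |η ω| ≤ C := ae_bdd_abs_condExp_of_ae_bdd_abs (ae_of_all _ hC)
  have hρm : Measurable[m] ρ := stronglyMeasurable_condExp.measurable
  have hηm : Measurable[m] η := stronglyMeasurable_condExp.measurable
  -- This d solves -ε η - d (1 - ε ρ) = 0, the conditional mean of (1 - ε h)(u - d). As ε ρ ≤ 1/2,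
  -- the denominator costs a factor 2.
  have hdm : Measurable[m] fun ω => -(ε * η ω / (1 - ε * ρ ω)) :=
    ((hηm.const_mul ε).div ((hρm.const_mul ε).const_sub 1)).neg
  have hdb : ∀ᵐ ω ∂μ, |-(ε * η ω / (1 - ε * ρ ω))| ≤ 2 * ε * C := by
    filter_upwards [hρ0, hρ1, hηC] with ω a1 a2 a3
    have hden : 1 / 2 ≤ 1 - ε * ρ ω := by nlinarith
    rw [abs_neg, abs_div, abs_mul, abs_of_pos hε, abs_of_pos (by linarith : 0 < 1 - ε * ρ ω),
      div_le_iff₀ (by linarith)]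
    have hC0 : 0 ≤ C := (abs_nonneg _).trans a3
    nlinarith [mul_nonneg hε.le hC0, mul_le_mul_of_nonneg_left a3 hε.le,
      mul_le_mul_of_nonneg_left hden (mul_nonneg hε.le hC0)]
  refine ⟨_, hdm, hdb, ?_⟩
  set d : α → ℝ := fun ω => -(ε * η ω / (1 - ε * ρ ω)) with hd
  have iw : Integrable (fun ω => 1 - ε * h ω) μ := (integrable_const 1).sub (ih.const_mul ε)
  have idw : Integrable (fun ω => d ω * (1 - ε * h ω)) μ :=
    iw.bdd_mul (hdm.mono hm le_rfl).aestronglyMeasurable hdb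
  have e1 : (fun ω => (1 - ε * h ω) * (u ω - d ω))
      = (u - ε • fun ω => h ω * u ω) - (fun ω => d ω * (1 - ε * h ω)) := by
    ext ω; simp only [Pi.sub_apply, Pi.smul_apply, smul_eq_mul]; ring
  have e2 : (fun ω => 1 - ε * h ω) = (fun _ => (1 : ℝ)) - ε • h := by
    ext ω; simp
  have c1 := condExp_sub (m := m) (hu.sub (ihu.smul ε)) idw
  have c2 := condExp_sub (m := m) hu (ihu.smul ε)
  have c3 : μ[ε • fun ω => h ω * u ω | m] =ᵐ[μ] ε • η := condExp_smul ε _ m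
  have c4 : μ[fun ω => d ω * (1 - ε * h ω) | m] =ᵐ[μ] _ :=
    condExp_mul_of_stronglyMeasurable_left hdm.stronglyMeasurable idw iw
  have c5 := condExp_sub (m := m) (integrable_const (1 : ℝ)) (ih.smul ε)
  have c6 : μ[ε • h | m] =ᵐ[μ] ε • ρ := condExp_smul ε _ m
  rw [e1]
  rw [e2] at c4
  rw [condExp_const hm] at c5
  filter_upwards [c1, c2, c3, c4, c5, c6, hu0, hρ0, hρ1] with ω b1 b2 b3 b4 b5 b6 b7 b8 b9
  have hden : 1 - ε * ρ ω ≠ 0 := by nlinarith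
  rw [b1, Pi.sub_apply, b2, Pi.sub_apply, b3, b4, Pi.mul_apply, b5, Pi.sub_apply, b6, b7]
  simp only [hd, Pi.smul_apply, smul_eq_mul, Pi.zero_apply]
  field_simp
  ring

/-- The `σ`-algebra of the first of two planar variables. -/
abbrev fstAlgebra : MeasurableSpace ((ℝ × ℝ) × (ℝ × ℝ)) :=
  MeasurableSpace.comap Prod.fst inferInstance

/-- The first-order condition of optimality: bounded parts of an optimal plan cannot be improved by
moving their mass to a common barycenter. -/
theorem IsOptimalPlan.integral_mul_cost_le {ν : Measure (ℝ × ℝ)}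
    {γ : Measure ((ℝ × ℝ) × (ℝ × ℝ))} (hγ : IsOptimalPlan ν γ) {h : (ℝ × ℝ) × (ℝ × ℝ) → ℝ}
    (hh : Measurable h) (h0 : ∀ z, 0 ≤ h z) (h1 : ∀ z, h z ≤ 1) {C : ℝ}
    (hC1 : ∀ z, |h z * (z.2.1 - z.1.1)| ≤ C) (hC2 : ∀ z, |h z * (z.2.2 - z.1.2)| ≤ C)
    {p : ℝ × ℝ} (hp1 : ∫ z, h z * (p.1 - z.2.1) ∂γ = 0) (hp2 : ∫ z, h z * (p.2 - z.2.2) ∂γ = 0) :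
    ∫ z, h z * (cost z.1 z.2 - cost p z.2) ∂γ ≤ 0 := by
  have hpl := hγ.1
  have := hpl.isProb
  have hm : fstAlgebra ≤ Prod.instMeasurableSpace := measurable_fst.comap_le
  have hfst : Measurable[fstAlgebra] (Prod.fst : (ℝ × ℝ) × (ℝ × ℝ) → ℝ × ℝ) := comap_measurable _
  have mx1 : Measurable[fstAlgebra] fun z : (ℝ × ℝ) × (ℝ × ℝ) => z.1.1 := measurable_fst.comp hfst
  have mx2 : Measurable[fstAlgebra] fun z : (ℝ × ℝ) × (ℝ × ℝ) => z.1.2 := measurable_snd.comp hfst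
  have L := hpl.memLp
  have Lx : MemLp (fun z : (ℝ × ℝ) × (ℝ × ℝ) => z.1) 2 γ := L.fst
  have Ly : MemLp (fun z : (ℝ × ℝ) × (ℝ × ℝ) => z.2) 2 γ := L.snd
  have ix1 := Lx.fst.integrable one_le_two
  have ix2 := Lx.snd.integrable one_le_two
  have iy1 := Ly.fst.integrable one_le_two
  have iy2 := Ly.snd.integrable one_le_two
  have u1 : γ[fun z : (ℝ × ℝ) × (ℝ × ℝ) => z.2.1 - z.1.1 | fstAlgebra] =ᵐ[γ] 0 := by
    have := (condExp_neg (μ := γ) (fun z : (ℝ × ℝ) × (ℝ × ℝ) => z.1.1 - z.2.1) fstAlgebra)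
    have h2 := condExp_sub_eq_zero hm mx1 ix1 iy1 hpl.martingale_fst
    filter_upwards [this, h2] with z a1 a2
    have e : (fun z : (ℝ × ℝ) × (ℝ × ℝ) => z.2.1 - z.1.1)
      = -(fun z : (ℝ × ℝ) × (ℝ × ℝ) => z.1.1 - z.2.1) := by ext z; simp
    rw [e, a1, Pi.neg_apply, a2]; simp
  have u2 : γ[fun z : (ℝ × ℝ) × (ℝ × ℝ) => z.2.2 - z.1.2 | fstAlgebra] =ᵐ[γ] 0 := by
    have := (condExp_neg (μ := γ) (fun z : (ℝ × ℝ) × (ℝ × ℝ) => z.1.2 - z.2.2) fstAlgebra)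
    have h2 := condExp_sub_eq_zero hm mx2 ix2 iy2 hpl.martingale_snd
    filter_upwards [this, h2] with z a1 a2
    have e : (fun z : (ℝ × ℝ) × (ℝ × ℝ) => z.2.2 - z.1.2)
      = -(fun z : (ℝ × ℝ) × (ℝ × ℝ) => z.1.2 - z.2.2) := by ext z; simp
    rw [e, a1, Pi.neg_apply, a2]; simp
  have hhb : ∀ᵐ z ∂γ, ‖h z‖ ≤ 1 :=
    ae_of_all _ fun z => by rw [Real.norm_eq_abs, abs_of_nonneg (h0 z)]; exact h1 z
  have ic : Integrable (fun z : (ℝ × ℝ) × (ℝ × ℝ) => cost z.1 z.2) γ := integrable_cost Lx Ly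
  have icp : Integrable (fun z : (ℝ × ℝ) × (ℝ × ℝ) => cost p z.2) γ :=
    integrable_cost (memLp_const p) Ly
  have ihc : Integrable (fun z => h z * cost z.1 z.2) γ := ic.bdd_mul hh.aestronglyMeasurable hhb
  have ihcp : Integrable (fun z => h z * cost p z.2) γ := icp.bdd_mul hh.aestronglyMeasurable hhb
  set I := ∫ z, h z * (cost z.1 z.2 - cost p z.2) ∂γ with hI
  have hIeq : I = ∫ z, h z * cost z.1 z.2 ∂γ - ∫ z, h z * cost p z.2 ∂γ := by
    rw [hI, ← integral_sub ihc ihcp]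
    simp only [mul_sub]
  -- Competitor: the part ε h of γ moves to its y-barycenter p, and the rest is recentered by d =
  -- O(ε). The change in cost is -ε I up to second order.
  have main : ∀ ε : ℝ, 0 < ε → ε ≤ 1 / 2 → I ≤ 8 * C ^ 2 * ε := by
    intro ε hε hε'
    obtain ⟨d1, md1, bd1, zd1⟩ := exists_recentering hm hh h0 h1 (iy1.sub ix1) u1 hC1 hε hε'
    obtain ⟨d2, md2, bd2, zd2⟩ := exists_recentering hm hh h0 h1 (iy2.sub ix2) u2 hC2 hε hε'
    have md1' := md1.mono hm le_rfl
    have md2' := md2.mono hm le_rfl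
    have Ld1 : MemLp d1 2 γ := MemLp.of_bound md1'.aestronglyMeasurable _ bd1
    have Ld2 : MemLp d2 2 γ := MemLp.of_bound md2'.aestronglyMeasurable _ bd2
    set X : (ℝ × ℝ) × (ℝ × ℝ) → ℝ × ℝ := fun z => (z.1.1 + d1 z, z.1.2 + d2 z) with hX
    have mX : Measurable[fstAlgebra] X := (mx1.add md1).prodMk (mx2.add md2)
    have mX' : Measurable X := mX.mono hm le_rfl
    have LX : MemLp X 2 γ := memLp_prod_iff.2 ⟨Lx.fst.add Ld1, Lx.snd.add Ld2⟩
    have hw0 : ∀ z, 0 ≤ ε * h z := fun z => mul_nonneg hε.le (h0 z)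
    have hw1 : ∀ z, ε * h z ≤ 1 := fun z => by nlinarith [h1 z, h0 z]
    have hvb : ∀ᵐ z ∂γ, ‖1 - ε * h z‖ ≤ 1 := ae_of_all _ fun z => by
      rw [Real.norm_eq_abs, abs_of_nonneg (by linarith [hw1 z])]; linarith [hw0 z]
    have mv : AEStronglyMeasurable (fun z => 1 - ε * h z) γ :=
      ((hh.const_mul ε).const_sub 1).aestronglyMeasurable
    have bary : ∀ (f g d : (ℝ × ℝ) × (ℝ × ℝ) → ℝ), Integrable f γ → Integrable g γ →
        Integrable d γ → γ[fun z => (1 - ε * h z) * (g z - f z - d z) | fstAlgebra] =ᵐ[γ] 0 →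
        ∀ s, MeasurableSet s → ∫ z in X ⁻¹' s, (1 - ε * h z) * (f z + d z) ∂γ
          = ∫ z in X ⁻¹' s, (1 - ε * h z) * g z ∂γ := by
      intro f g d hf hg hd hz s hs
      have i1 : Integrable (fun z => (1 - ε * h z) * (f z + d z)) γ := (hf.add hd).bdd_mul mv hvb
      have i2 : Integrable (fun z => (1 - ε * h z) * g z) γ := hg.bdd_mul mv hvb
      have i3 : Integrable (fun z => (1 - ε * h z) * (g z - f z - d z)) γ :=
        ((hg.sub hf).sub hd).bdd_mul mv hvb
      have e := setIntegral_condExp hm i3 (mX hs)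
      rw [setIntegral_congr_ae (g := fun _ => (0 : ℝ)) (mX' hs)
        (by filter_upwards [hz] with z hz _ using hz), integral_zero] at e
      rw [← sub_eq_zero, ← neg_eq_zero, neg_sub, ← integral_sub i2.integrableOn i1.integrableOn]
      refine Eq.trans ?_ e.symm
      congr 1; ext z; ring
    have hconst : ∀ (c : ℝ) (f : (ℝ × ℝ) × (ℝ × ℝ) → ℝ), Integrable f γ →
        ∫ z, h z * (c - f z) ∂γ = 0 → ∀ s : Set (ℝ × ℝ),
        ∫ z in (fun _ : (ℝ × ℝ) × (ℝ × ℝ) => p) ⁻¹' s, ε * h z * c ∂γ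
          = ∫ z in (fun _ : (ℝ × ℝ) × (ℝ × ℝ) => p) ⁻¹' s, ε * h z * f z ∂γ := by
      intro c f hf hz s
      by_cases hs : p ∈ s
      · rw [Set.preimage_const_of_mem hs, Measure.restrict_univ, ← sub_eq_zero]
        have i1 : Integrable (fun z => h z * c) γ :=
          (integrable_const c).bdd_mul hh.aestronglyMeasurable hhb
        have i2 : Integrable (fun z => h z * f z) γ := hf.bdd_mul hh.aestronglyMeasurable hhb
        simp only [mul_assoc, integral_const_mul]
        rw [← mul_sub, ← integral_sub i1 i2]
        simp only [← mul_sub, hz, mul_zero]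
      · simp [Set.preimage_const_of_notMem hs]
    obtain ⟨hpl', hcost⟩ := isPlan_transported_add (X' := fun _ => p) hpl (hh.const_mul ε) hw0 hw1
      mX' measurable_const LX (memLp_const p)
      (fun s hs => ⟨bary _ _ _ ix1 iy1 (Ld1.integrable one_le_two) zd1 s hs,
        bary _ _ _ ix2 iy2 (Ld2.integrable one_le_two) zd2 s hs⟩)
      (fun s _ => ⟨hconst _ _ iy1 hp1 s, hconst _ _ iy2 hp2 s⟩)
    have hopt := hγ.2 _ hpl'
    rw [hcost] at hopt
    have iXc : Integrable (fun z => (1 - ε * h z) * cost (X z) z.2) γ :=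
      (integrable_cost LX Ly).bdd_mul mv hvb
    have id1 : Integrable (fun z => d1 z * (z.2.2 - z.1.2)) γ :=
      integrable_mul_of_memLp Ld1 (Ly.snd.sub Lx.snd)
    have id2 : Integrable (fun z => d2 z * (z.2.1 - z.1.1)) γ :=
      integrable_mul_of_memLp Ld2 (Ly.fst.sub Lx.fst)
    -- The recentering is free to first order: d depends on x only, and y - x has conditional mean
    -- zero.
    have z1 := integral_mul_eq_zero hm md1 id1 (iy2.sub ix2) u2
    have z2 := integral_mul_eq_zero hm md2 id2 (iy1.sub ix1) u1
    have j1 : Integrable (fun z => cost z.1 z.2 - ε * (h z * cost z.1 z.2)) γ :=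
      ic.sub (ihc.const_mul ε)
    have j2 : Integrable (fun z => cost z.1 z.2 - ε * (h z * cost z.1 z.2)
        - d1 z * (z.2.2 - z.1.2)) γ := j1.sub id1
    have j3 : Integrable (fun z => cost z.1 z.2 - ε * (h z * cost z.1 z.2)
        - d1 z * (z.2.2 - z.1.2) - d2 z * (z.2.1 - z.1.1)) γ := j2.sub id2
    -- The constant 8 is 2 + 2 from the products of ε d with h (y - x), plus 4 from the product of
    -- the two shifts.
    have hbound : ∫ z, (1 - ε * h z) * cost (X z) z.2 ∂γ ≤
        ∫ z, (cost z.1 z.2 - ε * (h z * cost z.1 z.2) - d1 z * (z.2.2 - z.1.2)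
          - d2 z * (z.2.1 - z.1.1) + 8 * C ^ 2 * ε ^ 2) ∂γ := by
      refine integral_mono_ae iXc (j3.add (integrable_const _)) ?_
      filter_upwards [bd1, bd2] with z b1 b2
      have hC0 : 0 ≤ C := (abs_nonneg _).trans (hC1 z)
      have q1 : |d1 z * (h z * (z.2.2 - z.1.2))| ≤ 2 * ε * C * C := by
        rw [abs_mul]; exact mul_le_mul b1 (hC2 z) (abs_nonneg _) (by positivity)
      have q2 : |d2 z * (h z * (z.2.1 - z.1.1))| ≤ 2 * ε * C * C := by
        rw [abs_mul]; exact mul_le_mul b2 (hC1 z) (abs_nonneg _) (by positivity)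
      have q3 : |(1 - ε * h z) * (d1 z * d2 z)| ≤ 1 * ((2 * ε * C) * (2 * ε * C)) := by
        rw [abs_mul, abs_mul]
        refine mul_le_mul ?_ (mul_le_mul b1 b2 (abs_nonneg _) (by positivity)) (by positivity)
          zero_le_one
        rw [abs_of_nonneg (by linarith [hw1 z])]; linarith [hw0 z]
      have r1 := mul_le_mul_of_nonneg_left (abs_le.1 q1).2 hε.le
      have r2 := mul_le_mul_of_nonneg_left (abs_le.1 q2).2 hε.le
      have r3 := (abs_le.1 q3).2
      have e : (1 - ε * h z) * cost (X z) z.2 = cost z.1 z.2 - ε * (h z * cost z.1 z.2)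
          - d1 z * (z.2.2 - z.1.2) - d2 z * (z.2.1 - z.1.1)
          + (ε * (d1 z * (h z * (z.2.2 - z.1.2))) + ε * (d2 z * (h z * (z.2.1 - z.1.1)))
            + (1 - ε * h z) * (d1 z * d2 z)) := by
        simp only [cost, hX]; ring
      rw [e]
      nlinarith
    rw [integral_add j3 (integrable_const _), integral_sub j2 id2, integral_sub j1 id1,
      integral_sub ic (ihc.const_mul ε),
      integral_const_mul, z1, z2, integral_const, probReal_univ, one_smul] at hbound
    have e3 : ∫ z, ε * h z * cost p z.2 ∂γ = ε * ∫ z, h z * cost p z.2 ∂γ := by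
      simp only [mul_assoc, integral_const_mul]
    have : ε * I ≤ ε * (8 * C ^ 2 * ε) := by
      rw [hIeq, mul_sub]
      rw [e3] at hopt
      nlinarith
    exact le_of_mul_le_mul_left this hε
  have hlim := ge_of_tendsto (f := fun ε : ℝ => 8 * C ^ 2 * ε)
    (x := nhdsWithin 0 (Set.Ioi 0)) (a := 8 * C ^ 2 * 0) (b := I)
    ((Continuous.tendsto (by fun_prop) _).mono_left nhdsWithin_le_nhds)
    (by filter_upwards [Ioc_mem_nhdsGT (by norm_num : (0 : ℝ) < 1 / 2)] with ε hε
        using main ε hε.1 hε.2)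
  simpa using hlim

/-! ### Dual attainment from an optimal plan -/

lemma abs_setIntegral_sub_le {α : Type*} {m0 : MeasurableSpace α} {μ : Measure α}
    [IsProbabilityMeasure μ] {f : α → ℝ} (hf : Integrable f μ) {B : Set α}
    {a κ : ℝ} (h : ∀ z ∈ B, |f z - a| ≤ κ) :
    |∫ z in B, f z ∂μ - μ.real B * a| ≤ κ * μ.real B := by
  have h1 := norm_setIntegral_le_of_norm_le_const (μ := μ) (s := B) (f := fun z => f z - a)
    (measure_lt_top μ B) (C := κ) h
  rwa [integral_sub hf.integrableOn (integrable_const a), setIntegral_const, smul_eq_mul,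
    Real.norm_eq_abs] at h1

/-- Pairs of points in the support of an optimal plan satisfy the optimality condition for merging
masses `a` and `1 - a` at their barycenter. -/
lemma IsOptimalPlan.support_pair {ν : Measure (ℝ × ℝ)} {γ : Measure ((ℝ × ℝ) × (ℝ × ℝ))}
    (hγ : IsOptimalPlan ν γ) {p p' : (ℝ × ℝ) × (ℝ × ℝ)} (hp : p ∈ γ.support)
    (hp' : p' ∈ γ.support) {a : ℝ} (ha0 : 0 ≤ a) (ha1 : a ≤ 1) {c : ℝ × ℝ}
    (hc1 : c.1 = a * p.2.1 + (1 - a) * p'.2.1) (hc2 : c.2 = a * p.2.2 + (1 - a) * p'.2.2) :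
    a * (cost p.1 p.2 - cost c p.2) + (1 - a) * (cost p'.1 p'.2 - cost c p'.2) ≤ 0 := by
  have hpl := hγ.1
  have := hpl.isProb
  set k : (ℝ × ℝ) × (ℝ × ℝ) → ℝ := fun z => cost z.1 z.2 - cost c z.2 with hk
  have kcont : Continuous k := by simp only [hk, cost]; fun_prop
  have nbhd : ∀ q ∈ γ.support, ∀ κ > 0, ∃ B, MeasurableSet B ∧ 0 < γ.real B ∧ ∀ z ∈ B,
      |z.2.1 - q.2.1| ≤ κ ∧ |z.2.2 - q.2.2| ≤ κ ∧ |k z - k q| ≤ κ ∧ |‖z‖ - ‖q‖| ≤ κ := by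
    intro q hq κ hκ
    have ev : ∀ f : (ℝ × ℝ) × (ℝ × ℝ) → ℝ, Continuous f → ∀ᶠ z in nhds q, |f z - f q| ≤ κ := by
      intro f hf
      filter_upwards [hf.continuousAt.eventually (Metric.closedBall_mem_nhds _ hκ)] with z hz
      rwa [Real.dist_eq] at hz
    obtain ⟨r, hr, hB⟩ := Metric.eventually_nhds_iff_ball.1
      ((ev (fun z => z.2.1) (by fun_prop)).and ((ev (fun z => z.2.2) (by fun_prop)).and
        ((ev k kcont).and (ev (fun z => ‖z‖) (by fun_prop)))))
    refine ⟨Metric.ball q r, measurableSet_ball, ?_, hB⟩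
    exact ENNReal.toReal_pos
      (((Measure.mem_support_iff_forall q).1 hq _ (Metric.ball_mem_nhds q hr)).ne')
      (measure_ne_top _ _)
  have main : ∀ κ > 0, a * k p + (1 - a) * k p' ≤ κ + κ ^ 2 := by
    intro κ hκ
    obtain ⟨B, mB, bpos, hB⟩ := nbhd p hp κ hκ
    obtain ⟨B', mB', bpos', hB'⟩ := nbhd p' hp' κ hκ
    set b := γ.real B
    set b' := γ.real B'
    have hb1 : b ≤ 1 := measureReal_le_one
    have hb1' : b' ≤ 1 := measureReal_le_one
    have hM : 0 < b * b' := mul_pos bpos bpos'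
    -- The crossed factors b' and b equalize the two neighborhoods: they receive masses a b b' and
    -- (1 - a) b b'.
    set h : (ℝ × ℝ) × (ℝ × ℝ) → ℝ := fun z =>
      a * b' * B.indicator 1 z + (1 - a) * b * B'.indicator 1 z with hh
    have ind01 : ∀ (A : Set ((ℝ × ℝ) × (ℝ × ℝ))) z,
        0 ≤ A.indicator (1 : (ℝ × ℝ) × (ℝ × ℝ) → ℝ) z ∧
        A.indicator (1 : (ℝ × ℝ) × (ℝ × ℝ) → ℝ) z ≤ 1 := fun A z => by
      by_cases hz : z ∈ A <;> simp [hz]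
    have mh : Measurable h := ((measurable_one.indicator mB).const_mul _).add
      ((measurable_one.indicator mB').const_mul _)
    have h0 : ∀ z, 0 ≤ h z := fun z =>
      add_nonneg (mul_nonneg (mul_nonneg ha0 bpos'.le) (ind01 B z).1)
        (mul_nonneg (mul_nonneg (by linarith) bpos.le) (ind01 B' z).1)
    have h1 : ∀ z, h z ≤ 1 := fun z => by
      have e1 : a * b' * B.indicator 1 z ≤ a * 1 * 1 :=
        mul_le_mul (mul_le_mul_of_nonneg_left hb1' ha0) (ind01 B z).2 (ind01 B z).1 (by linarith)
      have e2 : (1 - a) * b * B'.indicator 1 z ≤ (1 - a) * 1 * 1 :=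
        mul_le_mul (mul_le_mul_of_nonneg_left hb1 (by linarith)) (ind01 B' z).2 (ind01 B' z).1
          (by linarith)
      simp only [hh]; linarith
    have hsplit : ∀ f : (ℝ × ℝ) × (ℝ × ℝ) → ℝ, Integrable f γ →
        ∫ z, h z * f z ∂γ = a * b' * ∫ z in B, f z ∂γ + (1 - a) * b * ∫ z in B', f z ∂γ := by
      intro f hf
      have e : (fun z => h z * f z)
          = fun z => a * b' * B.indicator f z + (1 - a) * b * B'.indicator f z := by
        ext z
        have e1 : ∀ A : Set ((ℝ × ℝ) × (ℝ × ℝ)),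
            A.indicator f z = A.indicator 1 z * f z := fun A => by
          by_cases hz : z ∈ A <;> simp [hz]
        rw [e1, e1]; simp only [hh]; ring
      rw [e, integral_add ((hf.indicator mB).const_mul _) ((hf.indicator mB').const_mul _),
        integral_const_mul, integral_const_mul, integral_indicator mB, integral_indicator mB']
    have havg : ∀ f : (ℝ × ℝ) × (ℝ × ℝ) → ℝ, Integrable f γ → ∀ t t',
        (∀ z ∈ B, |f z - t| ≤ κ) → (∀ z ∈ B', |f z - t'| ≤ κ) →
        |∫ z, h z * f z ∂γ - b * b' * (a * t + (1 - a) * t')| ≤ κ * (b * b') := by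
      intro f hf t t' ht ht'
      have e1 := abs_setIntegral_sub_le hf ht
      have e2 := abs_setIntegral_sub_le hf ht'
      rw [hsplit f hf]
      have w1 : 0 ≤ a * b' := mul_nonneg ha0 bpos'.le
      have w2 : 0 ≤ (1 - a) * b := mul_nonneg (by linarith) bpos.le
      rw [abs_le] at e1 e2 ⊢
      constructor
      · nlinarith [mul_le_mul_of_nonneg_left e1.1 w1, mul_le_mul_of_nonneg_left e2.1 w2]
      · nlinarith [mul_le_mul_of_nonneg_left e1.2 w1, mul_le_mul_of_nonneg_left e2.2 w2]
    have L := hpl.memLp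
    have Lx : MemLp (fun z : (ℝ × ℝ) × (ℝ × ℝ) => z.1) 2 γ := L.fst
    have Ly : MemLp (fun z : (ℝ × ℝ) × (ℝ × ℝ) => z.2) 2 γ := L.snd
    have iy1 := Ly.fst.integrable one_le_two
    have iy2 := Ly.snd.integrable one_le_two
    have ik : Integrable k γ :=
      (integrable_cost Lx Ly).sub (integrable_cost (memLp_const c) Ly)
    have hMint : ∫ z, h z ∂γ = b * b' := by
      have := hsplit (fun _ => 1) (integrable_const 1)
      simp only [mul_one, setIntegral_const, smul_eq_mul] at this
      rw [this]; ring
    have hhb : ∀ᵐ z ∂γ, ‖h z‖ ≤ 1 :=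
      ae_of_all _ fun z => by rw [Real.norm_eq_abs, abs_of_nonneg (h0 z)]; exact h1 z
    have ih : Integrable h γ := Integrable.of_bound mh.aestronglyMeasurable 1 hhb
    have a1 := havg (fun z => z.2.1) iy1 p.2.1 p'.2.1 (fun z hz => (hB z hz).1)
      fun z hz => (hB' z hz).1
    have a2 := havg (fun z => z.2.2) iy2 p.2.2 p'.2.2 (fun z hz => (hB z hz).2.1)
      fun z hz => (hB' z hz).2.1
    have a3 := havg k ik (k p) (k p') (fun z hz => (hB z hz).2.2.1)
      fun z hz => (hB' z hz).2.2.1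
    rw [← hc1] at a1
    rw [← hc2] at a2
    -- The first-order condition needs the exact barycenter q of the weighted mass, which is only
    -- κ-close to c.
    set q : ℝ × ℝ := ((∫ z, h z * z.2.1 ∂γ) / (b * b'), (∫ z, h z * z.2.2 ∂γ) / (b * b')) with hq
    have q1 : ∫ z, h z * z.2.1 ∂γ = b * b' * q.1 := by
      simp only [hq]; field_simp
    have q2 : ∫ z, h z * z.2.2 ∂γ = b * b' * q.2 := by
      simp only [hq]; field_simp
    have ihy1 : Integrable (fun z => h z * z.2.1) γ := iy1.bdd_mul mh.aestronglyMeasurable hhb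
    have ihy2 : Integrable (fun z => h z * z.2.2) γ := iy2.bdd_mul mh.aestronglyMeasurable hhb
    have ihk : Integrable (fun z => h z * k z) γ := ik.bdd_mul mh.aestronglyMeasurable hhb
    have z1 : ∫ z, h z * (q.1 - z.2.1) ∂γ = 0 := by
      simp only [mul_sub]
      rw [integral_sub (ih.mul_const _) ihy1, integral_mul_const, hMint, q1, sub_self]
    have z2 : ∫ z, h z * (q.2 - z.2.2) ∂γ = 0 := by
      simp only [mul_sub]
      rw [integral_sub (ih.mul_const _) ihy2, integral_mul_const, hMint, q2, sub_self]
    have d1 : |q.1 - c.1| ≤ κ := by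
      rw [q1, ← mul_sub, abs_mul, abs_of_pos hM, mul_comm] at a1
      exact le_of_mul_le_mul_right a1 hM
    have d2 : |q.2 - c.2| ≤ κ := by
      rw [q2, ← mul_sub, abs_mul, abs_of_pos hM, mul_comm] at a2
      exact le_of_mul_le_mul_right a2 hM
    set C := 2 * (‖p‖ + ‖p'‖ + κ) with hC
    have hbd : ∀ z, z ∈ B ∨ z ∈ B' → 2 * ‖z‖ ≤ C := by
      rintro z (hz | hz)
      · have := (abs_le.1 (hB z hz).2.2.2).2
        rw [hC]; linarith [norm_nonneg p']
      · have := (abs_le.1 (hB' z hz).2.2.2).2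
        rw [hC]; linarith [norm_nonneg p]
    have hC0 : 0 ≤ C := by positivity
    have hC' : ∀ s t : (ℝ × ℝ) × (ℝ × ℝ) → ℝ, (∀ z, |s z| ≤ ‖z‖) → (∀ z, |t z| ≤ ‖z‖) →
        ∀ z, |h z * (s z - t z)| ≤ C := by
      intro s t hs ht z
      by_cases hz : z ∈ B ∨ z ∈ B'
      · rw [abs_mul, abs_of_nonneg (h0 z)]
        calc h z * |s z - t z| ≤ 1 * (2 * ‖z‖) :=
              mul_le_mul (h1 z) ((abs_sub _ _).trans (by linarith [hs z, ht z])) (abs_nonneg _)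
                zero_le_one
          _ ≤ C := by linarith [hbd z hz]
      · push Not at hz
        simp [hh, hz.1, hz.2, hC0]
    have n11 : ∀ z : (ℝ × ℝ) × (ℝ × ℝ), |z.1.1| ≤ ‖z‖ := fun z =>
      (norm_fst_le z.1).trans (norm_fst_le z)
    have n12 : ∀ z : (ℝ × ℝ) × (ℝ × ℝ), |z.1.2| ≤ ‖z‖ := fun z =>
      (norm_snd_le z.1).trans (norm_fst_le z)
    have n21 : ∀ z : (ℝ × ℝ) × (ℝ × ℝ), |z.2.1| ≤ ‖z‖ := fun z =>
      (norm_fst_le z.2).trans (norm_snd_le z)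
    have n22 : ∀ z : (ℝ × ℝ) × (ℝ × ℝ), |z.2.2| ≤ ‖z‖ := fun z =>
      (norm_snd_le z.2).trans (norm_snd_le z)
    have key := hγ.integral_mul_cost_le mh h0 h1 (hC' _ _ n21 n11) (hC' _ _ n22 n12) z1 z2
    have ez1 : Integrable (fun z => h z * (q.1 - z.2.1)) γ :=
      ((integrable_const q.1).sub iy1).bdd_mul mh.aestronglyMeasurable hhb
    have ez2 : Integrable (fun z => h z * (q.2 - z.2.2)) γ :=
      ((integrable_const q.2).sub iy2).bdd_mul mh.aestronglyMeasurable hhb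
    -- Replacing q by c costs c(c, q), of size κ², and cross terms that integrate to zero against h.
    have e : (fun z => h z * (cost z.1 z.2 - cost q z.2)) = fun z => h z * k z
        + (h z * cost c q + ((c.1 - q.1) * (h z * (q.2 - z.2.2))
          + (c.2 - q.2) * (h z * (q.1 - z.2.1)))) := by
      ext z
      simp only [hk, cost_eq_add c q z.2]; ring
    have i2 : Integrable (fun z => (c.1 - q.1) * (h z * (q.2 - z.2.2))
          + (c.2 - q.2) * (h z * (q.1 - z.2.1))) γ := (ez2.const_mul _).add (ez1.const_mul _)
    have i1 : Integrable (fun z => h z * cost c q) γ := ih.mul_const _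
    have i3 : Integrable (fun z => h z * cost c q + ((c.1 - q.1) * (h z * (q.2 - z.2.2))
          + (c.2 - q.2) * (h z * (q.1 - z.2.1)))) γ := i1.add i2
    rw [e, integral_add ihk i3, integral_add i1 i2,
      integral_add (ez2.const_mul _) (ez1.const_mul _), integral_const_mul, integral_const_mul,
      z1, z2, integral_mul_const, hMint] at key
    have hcq : |cost c q| ≤ κ ^ 2 := by
      simp only [cost]
      rw [abs_mul, abs_sub_comm, abs_sub_comm c.2, sq]
      exact mul_le_mul d1 d2 (abs_nonneg _) hκ.le
    have l1 := (abs_le.1 a3).1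
    have l2 := (abs_le.1 hcq).1
    have : b * b' * (a * k p + (1 - a) * k p') ≤ b * b' * (κ + κ ^ 2) := by
      nlinarith [mul_le_mul_of_nonneg_left l2 hM.le]
    exact le_of_mul_le_mul_left this hM
  have hlim := ge_of_tendsto (f := fun κ : ℝ => κ + κ ^ 2)
    (x := nhdsWithin 0 (Set.Ioi 0)) (a := 0 + 0 ^ 2) (b := a * k p + (1 - a) * k p')
    ((Continuous.tendsto (by fun_prop) _).mono_left nhdsWithin_le_nhds)
    (by filter_upwards [self_mem_nhdsWithin] with κ hκ using main κ hκ)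
  simpa using hlim

/-- Attainment in the dual problem, given an optimal plan. -/
theorem IsOptimalPlan.exists_maximalMonotone {ν : Measure (ℝ × ℝ)}
    {γ : Measure ((ℝ × ℝ) × (ℝ × ℝ))} (hγ : IsOptimalPlan ν γ) :
    ∃ G, IsMaximalMonotone G ∧ ∀ᵐ z ∂γ, ∀ g ∈ G, cost z.1 z.2 ≤ cost g z.2 := by
  have := hγ.1.isProb
  have hne := (Measure.nonempty_support (IsProbabilityMeasure.ne_zero γ)).image
    fun z : (ℝ × ℝ) × (ℝ × ℝ) => (z.2, -cost z.1 z.2)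
  suffices h : _ ∧ _ by
    obtain ⟨G, hG, h⟩ := exists_maximalMonotone_of_pairwise hne h.1 h.2
    refine ⟨G, hG, ?_⟩
    filter_upwards [Measure.support_mem_ae (μ := γ)] with z hz g hg
    simpa using h _ ⟨z, hz, rfl⟩ g hg
  constructor
  · rintro _ ⟨z, hz, rfl⟩
    have := hγ.support_pair hz hz (a := 1) zero_le_one le_rfl (c := z.2) (by simp) (by simp)
    simp only [cost_self] at this
    simp only
    linarith
  · rintro _ ⟨z, hz, rfl⟩ _ ⟨z', hz', rfl⟩ r h1 h2
    simp only at h1 h2 ⊢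
    set A := r - z.2.1 with hA
    set B := z'.2.1 - r with hB
    have hApos : 0 < A := by linarith
    have hBpos : 0 < B := by linarith
    have hAB : 0 < A + B := by linarith
    -- The weights place the barycenter at abscissa r. Its ordinate cancels in the end, leaving the
    -- compatibility of the two barriers at r.
    set c : ℝ × ℝ := (B / (A + B) * z.2.1 + (1 - B / (A + B)) * z'.2.1,
      B / (A + B) * z.2.2 + (1 - B / (A + B)) * z'.2.2) with hc
    have hc1 : c.1 = r := by
      simp only [hc]; field_simp; simp only [hA, hB]; ring
    have := hγ.support_pair hz hz' (a := B / (A + B)) (by positivity)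
      ((div_le_one hAB).2 (by linarith)) (c := c) rfl rfl
    have e1 : cost c z.2 = A * (c.2 - z.2.2) := by simp only [cost, hc1, hA]
    have e2 : cost c z'.2 = -B * (c.2 - z'.2.2) := by simp only [cost, hc1, hB]; ring
    rw [e1, e2, show 1 - B / (A + B) = A / (A + B) by field_simp; ring] at this
    have h3 : B * (cost z.1 z.2 - A * (c.2 - z.2.2))
        + A * (cost z'.1 z'.2 - -B * (c.2 - z'.2.2)) ≤ 0 := by
      have h4 : (B * (cost z.1 z.2 - A * (c.2 - z.2.2))
          + A * (cost z'.1 z'.2 - -B * (c.2 - z'.2.2))) / (A + B) ≤ 0 := by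
        refine le_trans (le_of_eq ?_) this
        ring
      by_contra! hpos
      exact absurd h4 (not_le.2 (div_pos hpos hAB))
    rw [← sub_nonneg]
    have e3 : z'.2.2 + -cost z'.1 z'.2 / B - (z.2.2 - -cost z.1 z.2 / A)
        = -(B * (cost z.1 z.2 - A * (c.2 - z.2.2))
          + A * (cost z'.1 z'.2 - -B * (c.2 - z'.2.2))) / (A * B) := by
      field_simp; ring
    rw [e3]
    exact div_nonneg (by linarith) (by positivity)

/-! ### From an equilibrium to a map -/

lemma profit_of_coe {f : ℝ → EReal} {u v q t : ℝ} (h : f (q + u) = (t : EReal)) :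
    profit f u v q = ((q * (v - t) : ℝ) : EReal) := by
  rw [profit, h]; push_cast; rfl

/-- The price f(r) lies in between: the insider at u can buy r - u and the one at u' can sell u' -
r. An infinite price would give one of them an infinite profit. -/
lemma sub_div_le_add_div_of_profit_le {f : ℝ → EReal} {u v k u' v' k' r : ℝ}
    (h : ∀ q, profit f u v q ≤ (k : EReal)) (h' : ∀ q, profit f u' v' q ≤ (k' : EReal))
    (hu : u < r) (hu' : r < u') : v - k / (r - u) ≤ v' + k' / (u' - r) := by
  have h1 := h (r - u)
  have h2 := h' (r - u')
  have hpos : 0 < r - u := by linarith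
  have hneg : r - u' < 0 := by linarith
  rw [profit, sub_add_cancel] at h1 h2
  induction hf : f r with
  | bot =>
    rw [hf, EReal.coe_sub_bot, EReal.coe_mul_top_of_pos hpos] at h1
    simp at h1
  | top =>
    rw [hf, EReal.sub_top, EReal.coe_mul_bot_of_neg hneg] at h2
    simp at h2
  | coe t =>
    rw [hf] at h1 h2
    have h1 : (r - u) * (v - t) ≤ k := by exact_mod_cast h1
    have h2 : (r - u') * (v' - t) ≤ k' := by exact_mod_cast h2
    have e1 : v - t ≤ k / (r - u) := by rw [le_div_iff₀ hpos]; linarith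
    have e2 : t - v' ≤ k' / (u' - r) := by rw [le_div_iff₀ (by linarith)]; linarith
    linarith

/-- A nonpositive product `(R - U) b` with `R` measurable and `E[b | m] = 0` is integrable, and its
mean does not depend on `R`. -/
lemma integrable_mul_of_nonpos {α : Type*} {m m0 : MeasurableSpace α} {μ : Measure α}
    [IsProbabilityMeasure μ] (hm : m ≤ m0) {R U b : α → ℝ} (hR : Measurable[m] R)
    (hU : MemLp U 2 μ) (hb : MemLp b 2 μ) (hb0 : μ[b | m] =ᵐ[μ] 0)
    (hle : ∀ᵐ ω ∂μ, (R ω - U ω) * b ω ≤ 0) :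
    Integrable (fun ω => (R ω - U ω) * b ω) μ ∧
      ∫ ω, (R ω - U ω) * b ω ∂μ = ∫ ω, -(U ω * b ω) ∂μ := by
  have iW : Integrable (fun ω => -(U ω * b ω)) μ := (integrable_mul_of_memLp hU hb).neg
  -- R need not be integrable; on |R| ≤ n the term R b has mean zero.
  set A : ℕ → Set α := fun n => {ω | |R ω| ≤ n} with hA
  have mA' : ∀ n, MeasurableSet[m] (A n) := fun n =>
    measurableSet_le (measurable_abs.comp hR) measurable_const
  have mA : ∀ n, MeasurableSet (A n) := fun n => hm _ (mA' n)
  have hcover : AECover μ Filter.atTop A :=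
    { ae_eventually_mem := ae_of_all _ fun ω => by
        obtain ⟨N, hN⟩ := exists_nat_ge |R ω|
        filter_upwards [Filter.eventually_ge_atTop N] with n hn
        exact hN.trans (by exact_mod_cast hn)
      measurableSet := mA }
  have hRn : ∀ n, Measurable[m] ((A n).indicator R) := fun n => hR.indicator (mA' n)
  have LRn : ∀ n, MemLp ((A n).indicator R) 2 μ := fun n =>
    MemLp.of_bound ((hRn n).mono hm le_rfl).aestronglyMeasurable n (ae_of_all _ fun ω => by
      by_cases h : ω ∈ A n
      · rw [Set.indicator_of_mem h]; exact h
      · simp [h])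
  have ip : ∀ n, Integrable (fun ω => (A n).indicator R ω * b ω) μ := fun n =>
    integrable_mul_of_memLp (LRn n) hb
  have zp : ∀ n, ∫ ω, (A n).indicator R ω * b ω ∂μ = 0 := fun n =>
    integral_mul_eq_zero hm (hRn n) (ip n) (hb.integrable one_le_two) hb0
  have eqon : ∀ n, Set.EqOn (fun ω => (A n).indicator R ω * b ω + -(U ω * b ω))
      (fun ω => (R ω - U ω) * b ω) (A n) := fun n ω h => by
    simp only [Set.indicator_of_mem h]; ring
  have ion : ∀ n, IntegrableOn (fun ω => (R ω - U ω) * b ω) (A n) μ := fun n =>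
    (((ip n).add iW).integrableOn).congr_fun (eqon n) (mA n)
  have zp' : ∀ n, ∫ ω in A n, (A n).indicator R ω * b ω ∂μ = 0 := fun n => by
    rw [setIntegral_eq_integral_of_forall_compl_eq_zero, zp n]
    intro ω hω
    simp [hω]
  have hset : ∀ n, ∫ ω in A n, (R ω - U ω) * b ω ∂μ = ∫ ω in A n, -(U ω * b ω) ∂μ := fun n => by
    rw [← setIntegral_congr_fun (mA n) (eqon n),
      integral_add (ip n).integrableOn iW.integrableOn, zp' n, zero_add]
  have hint : Integrable (fun ω => (R ω - U ω) * b ω) μ := by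
    -- By the sign, the absolute integral over A n is minus the signed one, which equals that of -U
    -- b and is bounded uniformly in n.
    refine hcover.integrable_of_integral_norm_bounded (∫ ω, ‖-(U ω * b ω)‖ ∂μ) ion
      (Filter.Eventually.of_forall fun n => ?_)
    calc ∫ ω in A n, ‖(R ω - U ω) * b ω‖ ∂μ = ∫ ω in A n, -((R ω - U ω) * b ω) ∂μ :=
          setIntegral_congr_ae (mA n) (by
            filter_upwards [hle] with ω h _
            rw [Real.norm_eq_abs, abs_of_nonpos h])
      _ = -∫ ω in A n, -(U ω * b ω) ∂μ := by rw [integral_neg, hset n]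
      _ ≤ ∫ ω in A n, ‖-(U ω * b ω)‖ ∂μ :=
          (neg_le_abs _).trans (norm_integral_le_integral_norm (fun ω => -(U ω * b ω)))
      _ ≤ ∫ ω, ‖-(U ω * b ω)‖ ∂μ :=
          setIntegral_le_integral iW.norm (ae_of_all _ fun ω => norm_nonneg _)
  refine ⟨hint, tendsto_nhds_unique (hcover.integral_tendsto_of_countably_generated hint) ?_⟩
  simp only [hset]
  exact hcover.integral_tendsto_of_countably_generated iW

/-- Every equilibrium comes with a map whose cost is minus the profit, and with a maximal
monotone set certifying its optimality. -/
theorem IsEquilibrium.exists_map {Ω : Type*} [MeasurableSpace Ω] {P : Measure Ω}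
    [IsProbabilityMeasure P] {U V Q : Ω → ℝ} {f : ℝ → EReal} (hU : Measurable U)
    (hV : Measurable V) (hU2 : MemLp U 2 P) (hV2 : MemLp V 2 P)
    (h : IsEquilibrium P U V Q f) :
    ∃ (X : Ω → ℝ × ℝ) (G : Set (ℝ × ℝ)), IsMap P (fun ω => (U ω, V ω)) X ∧ IsMaximalMonotone G ∧
      (∀ᵐ ω ∂P, ∀ g ∈ G, cost (X ω) (U ω, V ω) ≤ cost g (U ω, V ω)) ∧
      ∀ᵐ ω ∂P, profit f (U ω) (V ω) (Q ω) = -((cost (X ω) (U ω, V ω) : ℝ) : EReal) := by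
  have hY : Measurable fun ω => (U ω, V ω) := hU.prodMk hV
  have hY2 : MemLp (fun ω => (U ω, V ω)) 2 P := memLp_prod_iff.2 ⟨hU2, hV2⟩
  set R : Ω → ℝ := fun ω => Q ω + U ω with hR
  have hYc : Measurable[MeasurableSpace.comap (fun ω => (U ω, V ω)) inferInstance]
      fun ω => (U ω, V ω) := comap_measurable _
  have mRY : Measurable[MeasurableSpace.comap (fun ω => (U ω, V ω)) inferInstance] R :=
    h.measurable_order.add (measurable_fst.comp hYc)
  have mR : Measurable R := mRY.mono hY.comap_le le_rfl
  have mRc : Measurable[MeasurableSpace.comap R inferInstance] R := comap_measurable R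
  have hmR := mR.comap_le
  -- Nothing makes R square-integrable or equal to E[U | R], so the first coordinate of the map is
  -- M, not R.
  set M : Ω → ℝ := P[U | MeasurableSpace.comap R inferInstance] with hM
  set S : Ω → ℝ := P[V | MeasurableSpace.comap R inferInstance] with hS
  have mM : Measurable[MeasurableSpace.comap R inferInstance] M :=
    stronglyMeasurable_condExp.measurable
  have mS : Measurable[MeasurableSpace.comap R inferInstance] S :=
    stronglyMeasurable_condExp.measurable
  have LM : MemLp M 2 P := hU2.condExp one_le_two
  have LS : MemLp S 2 P := hV2.condExp one_le_two
  have LX : MemLp (fun ω => (M ω, S ω)) 2 P := memLp_prod_iff.2 ⟨LM, LS⟩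
  have mX : Measurable[MeasurableSpace.comap R inferInstance] fun ω => (M ω, S ω) :=
    mM.prodMk mS
  have hX : IsMap P (fun ω => (U ω, V ω)) fun ω => (M ω, S ω) :=
    isMap_of_condExp hY mRY.comap_le mX LX (ae_eq_refl _) (ae_eq_refl _)
  have good : ∀ᵐ ω ∂P, profit f (U ω) (V ω) (Q ω) = ((-((R ω - U ω) * (S ω - V ω)) : ℝ) : EReal) ∧
      ∀ q, profit f (U ω) (V ω) q ≤ ((-((R ω - U ω) * (S ω - V ω)) : ℝ) : EReal) := by
    filter_upwards [h.efficient, h.optimal] with ω h1 h2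
    have e : profit f (U ω) (V ω) (Q ω) = ((-((R ω - U ω) * (S ω - V ω)) : ℝ) : EReal) := by
      rw [profit_of_coe h1]
      congr 1
      simp only [hR, hS]; ring
    exact ⟨e, fun q => e ▸ h2 q⟩
  have hk : ∀ ω, (∀ q, profit f (U ω) (V ω) q ≤ ((-((R ω - U ω) * (S ω - V ω)) : ℝ) : EReal)) →
      0 ≤ -((R ω - U ω) * (S ω - V ω)) := fun ω hω => by
    have := hω 0
    rw [profit, EReal.coe_zero, zero_mul] at this
    exact_mod_cast this
  obtain ⟨G, hG, hGk⟩ := exists_maximalMonotone_of_pairwise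
    (T := (fun ω => ((U ω, V ω), -((R ω - U ω) * (S ω - V ω)))) ''
      {ω | ∀ q, profit f (U ω) (V ω) q ≤ ((-((R ω - U ω) * (S ω - V ω)) : ℝ) : EReal)})
    (Set.Nonempty.image _ (good.mono fun _ => And.right).exists)
    (by rintro _ ⟨ω, hω, rfl⟩; exact hk ω hω)
    (by
      rintro _ ⟨ω, hω, rfl⟩ _ ⟨ω', hω', rfl⟩ r h1 h2
      exact sub_div_le_add_div_of_profit_le hω hω' h1 h2)
  have Lb : MemLp (fun ω => S ω - V ω) 2 P := LS.sub hV2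
  have zb : P[fun ω => S ω - V ω | MeasurableSpace.comap R inferInstance] =ᵐ[P] 0 :=
    condExp_sub_eq_zero hmR mS (LS.integrable one_le_two) (hV2.integrable one_le_two)
      (ae_eq_refl _)
  obtain ⟨iD, eD⟩ := integrable_mul_of_nonpos hmR mRc hU2 Lb zb (by
    filter_upwards [good] with ω hω
    linarith [hk ω hω.2])
  have icost : Integrable (fun ω => M ω * (S ω - V ω)) P := integrable_mul_of_memLp LM Lb
  have iUb : Integrable (fun ω => U ω * (S ω - V ω)) P := integrable_mul_of_memLp hU2 Lb
  have eM : ∫ ω, cost (M ω, S ω) (U ω, V ω) ∂P = ∫ ω, -(U ω * (S ω - V ω)) ∂P := by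
    have e : (fun ω => cost (M ω, S ω) (U ω, V ω))
        = fun ω => M ω * (S ω - V ω) + -(U ω * (S ω - V ω)) := by
      ext ω; simp only [cost]; ring
    have z := integral_mul_eq_zero hmR mM icost (Lb.integrable one_le_two) zb
    have iUb' : Integrable (fun ω => -(U ω * (S ω - V ω))) P := iUb.neg
    rw [e, integral_add icost iUb', z, zero_add]
  -- Both (R - U)(S - V) and c(X, Y) have mean -E[U (S - V)], which is the case of equality.
  have hwd := (weak_duality hmR mX LX hY2 (ae_eq_refl _) (ae_eq_refl _) hG iD (by
    filter_upwards [good] with ω hω g hg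
    simpa using hGk _ ⟨ω, hω.2, rfl⟩ g hg)).2 (eD.trans eM.symm)
  refine ⟨fun ω => (M ω, S ω), G, hX, hG, ?_, ?_⟩
  · filter_upwards [good, hwd] with ω h1 h2 g hg
    rw [← h2.1]
    simpa using hGk _ ⟨ω, h1.2, rfl⟩ g hg
  · filter_upwards [good, hwd] with ω h1 h2
    rw [← h2.1, h1.1, EReal.coe_neg]

/-! ### Pricing rules selected from a maximal monotone set -/

/-- The largest value of a set `G` up to the abscissa `r`. -/
noncomputable def upperRule (G : Set (ℝ × ℝ)) (r : ℝ) : EReal :=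
  ⨆ z ∈ {z ∈ G | z.1 ≤ r}, (z.2 : EReal)

lemma le_upperRule {G : Set (ℝ × ℝ)} {z : ℝ × ℝ} (hz : z ∈ G) {r : ℝ} (h : z.1 ≤ r) :
    (z.2 : EReal) ≤ upperRule G r :=
  le_iSup₂_of_le (f := fun z (_ : z ∈ {z ∈ G | z.1 ≤ r}) => (z.2 : EReal)) z ⟨hz, h⟩ le_rfl

lemma IsMonotoneSet.snd_le {G : Set (ℝ × ℝ)} (hG : IsMonotoneSet G) {z z' : ℝ × ℝ} (hz : z ∈ G)
    (hz' : z' ∈ G) (h : z.1 < z'.1) : z.2 ≤ z'.2 := by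
  by_contra! h'
  have := hG z hz z' hz'
  simp only [cost] at this
  nlinarith

lemma upperRule_le {G : Set (ℝ × ℝ)} (hG : IsMonotoneSet G) {z : ℝ × ℝ} (hz : z ∈ G) {r : ℝ}
    (h : r < z.1) : upperRule G r ≤ (z.2 : EReal) :=
  iSup₂_le fun _ hz' => EReal.coe_le_coe_iff.2 (hG.snd_le hz'.1 hz (hz'.2.trans_lt h))

/-- G lies below t up to r and above t beyond r. In particular the rule is infinite off the
projection of G. -/
lemma mem_of_upperRule_eq_coe {G : Set (ℝ × ℝ)} (hG : IsMaximalMonotone G) {r t : ℝ}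
    (h : upperRule G r = (t : EReal)) : (r, t) ∈ G := by
  refine mem_of_forall_cost_nonneg hG fun g hg => ?_
  rcases le_or_gt g.1 r with hr | hr
  · have : g.2 ≤ t := EReal.coe_le_coe_iff.1 (h ▸ le_upperRule hg hr)
    exact mul_nonneg_of_nonpos_of_nonpos (by simpa using hr) (by simpa using this)
  · have : t ≤ g.2 := EReal.coe_le_coe_iff.1 (h ▸ upperRule_le hG.1 hg hr)
    exact mul_nonneg (by simpa using hr.le) (by simpa using this)

open Classical in
/-- The selection of the maximal monotone set `G` that agrees with `h` where this is possible. -/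
noncomputable def selection (G : Set (ℝ × ℝ)) (h : ℝ → ℝ) (r : ℝ) : EReal :=
  if (r, h r) ∈ G then (h r : EReal) else upperRule G r

lemma selection_of_mem {G : Set (ℝ × ℝ)} {h : ℝ → ℝ} {r : ℝ} (hr : (r, h r) ∈ G) :
    selection G h r = (h r : EReal) := if_pos hr

lemma monotone_selection {G : Set (ℝ × ℝ)} (hG : IsMonotoneSet G) (h : ℝ → ℝ) :
    Monotone (selection G h) := by
  intro r r' hle
  rcases hle.eq_or_lt with rfl | hlt
  · exact le_rfl
  by_cases h1 : (r, h r) ∈ G <;> by_cases h2 : (r', h r') ∈ G <;>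
    simp only [selection, h1, h2, if_true, if_false]
  · exact EReal.coe_le_coe_iff.2 (hG.snd_le h1 h2 hlt)
  · exact le_upperRule h1 hle
  · exact upperRule_le hG h2 hlt
  · exact iSup₂_le fun z hz => le_upperRule hz.1 (hz.2.trans hle)

lemma mem_of_selection_eq_coe {G : Set (ℝ × ℝ)} (hG : IsMaximalMonotone G) {h : ℝ → ℝ} {r t : ℝ}
    (ht : selection G h r = (t : EReal)) : (r, t) ∈ G := by
  by_cases h1 : (r, h r) ∈ G <;> simp only [selection, h1, if_true, if_false] at ht
  · rwa [← EReal.coe_eq_coe_iff.1 ht]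
  · exact mem_of_upperRule_eq_coe hG ht

/-- Where a selection of `G` is `⊤`, the set `G` has points with arbitrarily large values to the
left. -/
lemma exists_of_selection_eq_top {G : Set (ℝ × ℝ)} {h : ℝ → ℝ} {r : ℝ}
    (ht : selection G h r = ⊤) (t : ℝ) : ∃ z ∈ G, z.1 ≤ r ∧ t < z.2 := by
  by_cases h1 : (r, h r) ∈ G <;> simp only [selection, h1, if_true, if_false] at ht
  · simp at ht
  · by_contra! hcon
    have : upperRule G r ≤ (t : EReal) :=
      iSup₂_le fun z hz => EReal.coe_le_coe_iff.2 (hcon z hz.1 hz.2)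
    rw [ht] at this
    simp at this

/-- All of G then lies to the right of r. If its values were bounded below by t, the point (r, t)
could be added. -/
lemma exists_of_selection_eq_bot {G : Set (ℝ × ℝ)} (hG : IsMaximalMonotone G) {h : ℝ → ℝ} {r : ℝ}
    (ht : selection G h r = ⊥) (t : ℝ) : ∃ z ∈ G, r < z.1 ∧ z.2 < t := by
  by_cases h1 : (r, h r) ∈ G <;> simp only [selection, h1, if_true, if_false] at ht
  · simp at ht
  · have hright : ∀ z ∈ G, r < z.1 := fun z hz => by
      by_contra! hcon
      have := le_upperRule hz hcon
      rw [ht] at this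
      simp at this
    by_contra! hcon
    have hmem : (r, t) ∈ G := mem_of_forall_cost_nonneg hG fun g hg =>
      mul_nonneg (by simpa using (hright g hg).le)
        (by simpa using hcon g hg (hright g hg))
    exact lt_irrefl _ (hright _ hmem)

/-- If `c(·, (u, v)) ≥ -k` on `G`, then `k` bounds the profit for all selections of `G`. -/
lemma profit_selection_le {G : Set (ℝ × ℝ)} (hG : IsMaximalMonotone G) (h : ℝ → ℝ) {u v k : ℝ}
    (hk0 : 0 ≤ k) (hk : ∀ g ∈ G, -k ≤ cost g (u, v)) (q : ℝ) :
    profit (selection G h) u v q ≤ (k : EReal) := by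
  induction hf : selection G h (q + u) with
  | coe t =>
    rw [profit_of_coe hf]
    have := hk _ (mem_of_selection_eq_coe hG hf)
    refine EReal.coe_le_coe_iff.2 ?_
    simp only [cost] at this
    linarith
  | top =>
    rcases lt_trichotomy q 0 with hq | rfl | hq
    -- A sale at price ⊤ is excluded: a high enough point of G to the left of u violates c ≥ -k.
    · obtain ⟨z, hz, h1, h2⟩ := exists_of_selection_eq_top hf (max v (v + k / (-q)))
      have h3 := hk z hz
      have h4 : v + k / (-q) < z.2 := (le_max_right _ _).trans_lt h2
      have h5 : v < z.2 := (le_max_left _ _).trans_lt h2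
      have h6 : k < (z.2 - v) * (-q) := by
        rw [← div_lt_iff₀ (by linarith)]; linarith
      simp only [cost] at h3
      nlinarith
    · rw [profit, EReal.coe_zero, zero_mul]; exact_mod_cast hk0
    · rw [profit, hf, EReal.sub_top, EReal.coe_mul_bot_of_pos hq]
      exact bot_le
  | bot =>
    rcases lt_trichotomy q 0 with hq | rfl | hq
    · rw [profit, hf, EReal.coe_sub_bot, EReal.coe_mul_top_of_neg hq]
      exact bot_le
    · rw [profit, EReal.coe_zero, zero_mul]; exact_mod_cast hk0
    · obtain ⟨z, hz, h1, h2⟩ := exists_of_selection_eq_bot hG hf (min v (v - k / q))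
      have h3 := hk z hz
      have h4 : z.2 < v - k / q := h2.trans_le (min_le_right _ _)
      have h5 : z.2 < v := h2.trans_le (min_le_left _ _)
      have h6 : k < (v - z.2) * q := by
        rw [← div_lt_iff₀ hq]; linarith
      simp only [cost] at h3
      nlinarith

/-! ### Equilibria and optimal maps -/

section Equilibrium

variable {Ω : Type*} [MeasurableSpace Ω] {P : Measure Ω} [IsProbabilityMeasure P] {U V : Ω → ℝ}

/-- In an optimal map the price coordinate may be averaged over the order coordinate. -/
lemma IsMap.average (hU : Measurable U) (hV : Measurable V) (hU2 : MemLp U 2 P)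
    (hV2 : MemLp V 2 P) {X : Ω → ℝ × ℝ} (hX : IsMap P (fun ω => (U ω, V ω)) X) :
    IsMap P (fun ω => (U ω, V ω))
        (fun ω => ((X ω).1, (P[V | MeasurableSpace.comap (fun ω => (X ω).1) inferInstance]) ω)) ∧
      ∫ ω, cost ((X ω).1, (P[V | MeasurableSpace.comap (fun ω => (X ω).1) inferInstance]) ω)
        (U ω, V ω) ∂P = ∫ ω, cost (X ω) (U ω, V ω) ∂P := by
  have hY : Measurable fun ω => (U ω, V ω) := hU.prodMk hV
  have mX := hX.measurable_map hY
  set R : Ω → ℝ := fun ω => (X ω).1 with hR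
  set S : Ω → ℝ := P[V | MeasurableSpace.comap R inferInstance] with hS
  have hXc : Measurable[MeasurableSpace.comap X inferInstance] X := comap_measurable X
  have mRX : Measurable[MeasurableSpace.comap X inferInstance] R := measurable_fst.comp hXc
  have hRX : MeasurableSpace.comap R inferInstance ≤ MeasurableSpace.comap X inferInstance :=
    mRX.comap_le
  have mRc : Measurable[MeasurableSpace.comap R inferInstance] R := comap_measurable R
  have mS : Measurable[MeasurableSpace.comap R inferInstance] S :=
    stronglyMeasurable_condExp.measurable
  have LR : MemLp R 2 P := hX.memLp.fst
  have LS : MemLp S 2 P := hV2.condExp one_le_two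
  have hRU : P[U | MeasurableSpace.comap R inferInstance] =ᵐ[P] R := by
    refine (condExp_condExp_of_le hRX mX.comap_le).symm.trans
      ((condExp_congr_ae hX.martingale_fst).trans (.of_eq ?_))
    exact condExp_of_stronglyMeasurable (hRX.trans mX.comap_le) mRc.stronglyMeasurable
      (LR.integrable one_le_two)
  refine ⟨isMap_of_condExp hY (hRX.trans hX.measurable.comap_le) (mRc.prodMk mS)
    (memLp_prod_iff.2 ⟨LR, LS⟩) hRU (ae_eq_refl _), ?_⟩
  have LY : MemLp (fun ω => (U ω, V ω)) 2 P := memLp_prod_iff.2 ⟨hU2, hV2⟩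
  have LXS : MemLp (fun ω => S ω - (X ω).2) 2 P := LS.sub hX.memLp.snd
  have i1 : Integrable (fun ω => (S ω - (X ω).2) * (R ω - U ω)) P :=
    integrable_mul_of_memLp LXS (LR.sub hU2)
  have i2 := integrable_cost hX.memLp LY
  -- The change in cost vanishes because S - X₂ is X-measurable and E[R - U | X] = 0.
  have z : ∫ ω, (S ω - (X ω).2) * (R ω - U ω) ∂P = 0 :=
    integral_mul_eq_zero mX.comap_le ((mS.mono hRX le_rfl).sub (measurable_snd.comp hXc)) i1
      ((LR.sub hU2).integrable one_le_two)
      (condExp_sub_eq_zero mX.comap_le mRX (LR.integrable one_le_two)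
        (hU2.integrable one_le_two) hX.martingale_fst)
  have e : (fun ω => cost (R ω, S ω) (U ω, V ω))
      = fun ω => cost (X ω) (U ω, V ω) + (S ω - (X ω).2) * (R ω - U ω) := by
    ext ω; simp only [cost, hR]; ring
  rw [e, integral_add i2 i1, z, add_zero]

/-- An optimal map whose joint law is an optimal plan yields an equilibrium with an increasing
pricing rule. -/
theorem exists_monotone_equilibrium (hU : Measurable U) (hV : Measurable V) (hU2 : MemLp U 2 P)
    (hV2 : MemLp V 2 P) {X : Ω → ℝ × ℝ} (hX : IsMap P (fun ω => (U ω, V ω)) X)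
    (hopt : IsOptimalPlan (P.map fun ω => (U ω, V ω)) (P.map fun ω => (X ω, (U ω, V ω)))) :
    ∃ (Q : Ω → ℝ) (f : ℝ → EReal) (R S : Ω → ℝ), IsEquilibrium P U V Q f ∧
      IsOptimalMap P (fun ω => (U ω, V ω)) (fun ω => (R ω, S ω)) ∧
      IsOptimalPlan (P.map fun ω => (U ω, V ω)) (P.map fun ω => ((R ω, S ω), (U ω, V ω))) ∧
      Monotone f ∧ (∀ᵐ ω ∂P, Q ω + U ω = R ω) ∧
      (∀ᵐ ω ∂P, f (Q ω + U ω) = ((S ω : ℝ) : EReal)) := by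
  have hY : Measurable fun ω => (U ω, V ω) := hU.prodMk hV
  have LY : MemLp (fun ω => (U ω, V ω)) 2 P := memLp_prod_iff.2 ⟨hU2, hV2⟩
  have mX := hX.measurable_map hY
  obtain ⟨G, hG, hle⟩ := hopt.exists_maximalMonotone
  have hdual := hopt.1.dualValue_eq hG hle
  obtain ⟨hX', hcost⟩ := hX.average hU hV hU2 hV2
  set R : Ω → ℝ := fun ω => (X ω).1 with hR
  set S : Ω → ℝ := P[V | MeasurableSpace.comap R inferInstance] with hS
  have mX' := hX'.measurable_map hY
  have hpl' := hX'.isPlan hY LY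
  have hint : ∫ z, cost z.1 z.2 ∂(P.map fun ω => ((R ω, S ω), (U ω, V ω)))
      = ∫ z, cost z.1 z.2 ∂(P.map fun ω => (X ω, (U ω, V ω))) := by
    rw [integral_cost_map mX' hY, integral_cost_map mX hY, hcost]
  -- The averaged map has the same cost, so it closes the gap with the same G and takes its values
  -- in G.
  rw [← hint] at hdual
  have hopt' := (hpl'.optimal_of_dualValue_eq hG hdual).1
  have hae := ae_of_ae_map (mX'.prodMk hY).aemeasurable ((hpl'.duality hG).2 hdual)
  have mS : Measurable[MeasurableSpace.comap R inferInstance] S :=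
    stronglyMeasurable_condExp.measurable
  -- Where G is vertical, the price S may be any point of the segment; selecting h there makes the
  -- rule return S exactly.
  obtain ⟨h, -, hSh⟩ := mS.exists_eq_measurable_comp
  have hYc : Measurable[MeasurableSpace.comap (fun ω => (U ω, V ω)) inferInstance]
      fun ω => (U ω, V ω) := comap_measurable _
  have hmono := monotone_selection hG.1 h
  have hprice : ∀ᵐ ω ∂P, selection G h (R ω) = ((S ω : ℝ) : EReal) := by
    filter_upwards [hae] with ω hω
    have e : S ω = h (R ω) := congrFun hSh ω
    rw [e]
    exact selection_of_mem (e ▸ hω.2)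
  have heq : IsEquilibrium P U V (fun ω => R ω - U ω) (selection G h) :=
    { measurable_order := (measurable_fst.comp hX.measurable).sub (measurable_fst.comp hYc)
      measurable_rule := hmono.measurable
      efficient := by
        simp only [sub_add_cancel]
        exact hprice
      optimal := by
        filter_upwards [hae, hprice] with ω h1 h2 q
        have hk : ∀ g ∈ G, cost (R ω, S ω) (U ω, V ω) ≤ cost g (U ω, V ω) := fun g hg =>
          EReal.coe_le_coe_iff.1 (h1.1 ▸ phi_le_cost hg (U ω, V ω))
        have hk0 : cost (R ω, S ω) (U ω, V ω) ≤ 0 := by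
          have := phi_nonpos hG (U ω, V ω)
          rw [h1.1] at this
          exact_mod_cast this
        have hp : profit (selection G h) (U ω) (V ω) (R ω - U ω)
            = ((-cost (R ω, S ω) (U ω, V ω) : ℝ) : EReal) := by
          rw [profit_of_coe (t := S ω) (by rw [sub_add_cancel]; exact h2)]
          congr 1
          simp only [cost]; ring
        rw [hp]
        exact profit_selection_le hG h (by linarith) (fun g hg => by simpa using hk g hg) q }
  exact ⟨_, _, R, S, heq, hX'.isOptimalMap_of_plan hY LY hopt', hopt', hmono,
    ae_of_all _ fun ω => sub_add_cancel _ _, by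
      simp only [sub_add_cancel]; exact hprice⟩

/-- The map of an equilibrium is optimal and gives the profit, and so do all optimal maps and dual
maximizers. -/
theorem IsEquilibrium.exists_optimal (hU : Measurable U) (hV : Measurable V) (hU2 : MemLp U 2 P)
    (hV2 : MemLp V 2 P) {Q : Ω → ℝ} {f : ℝ → EReal} (h : IsEquilibrium P U V Q f) :
    (∃ X, IsOptimalMap P (fun ω => (U ω, V ω)) X ∧
      IsOptimalPlan (P.map fun ω => (U ω, V ω)) (P.map fun ω => (X ω, (U ω, V ω)))) ∧
    (∃ G, IsDualMaximizer (P.map fun ω => (U ω, V ω)) G) ∧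
    (∀ X, IsOptimalMap P (fun ω => (U ω, V ω)) X →
      ∀ᵐ ω ∂P, profit f (U ω) (V ω) (Q ω) = -((cost (X ω) (U ω, V ω) : ℝ) : EReal)) ∧
    ∀ G, IsDualMaximizer (P.map fun ω => (U ω, V ω)) G →
      ∀ᵐ ω ∂P, profit f (U ω) (V ω) (Q ω) = -phi G (U ω, V ω) := by
  have hY : Measurable fun ω => (U ω, V ω) := hU.prodMk hV
  have LY : MemLp (fun ω => (U ω, V ω)) 2 P := memLp_prod_iff.2 ⟨hU2, hV2⟩
  obtain ⟨X, G, hX, hG, hle, hprofit⟩ := h.exists_map hU hV hU2 hV2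
  have mX := hX.measurable_map hY
  have hpl := hX.isPlan hY LY
  have hdual := hpl.dualValue_eq hG (ae_map_le_cost mX hY hle)
  obtain ⟨hopt, hmax⟩ := hpl.optimal_of_dualValue_eq hG hdual
  have hphi : ∀ G', IsDualMaximizer (P.map fun ω => (U ω, V ω)) G' →
      ∀ᵐ ω ∂P, profit f (U ω) (V ω) (Q ω) = -phi G' (U ω, V ω) := by
    intro G' hG'
    -- Any other maximizer also has no gap with X, so the case of equality identifies its φ; the
    -- same holds below for other optimal maps and G.
    have heq := (le_antisymm (hmax.2 G' hG'.1) (hG'.2 G hG)).trans hdual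
    have hae := ae_of_ae_map (mX.prodMk hY).aemeasurable ((hpl.duality hG'.1).2 heq)
    filter_upwards [hae, hprofit] with ω h1 h2
    rw [h2, h1.1]
  refine ⟨⟨X, hX.isOptimalMap_of_plan hY LY hopt, hopt⟩, ⟨G, hmax⟩, fun X' hX' => ?_, hphi⟩
  have mX' := hX'.1.measurable_map hY
  have hpl' := hX'.1.isPlan hY LY
  have hint : ∫ z, cost z.1 z.2 ∂(P.map fun ω => (X ω, (U ω, V ω)))
      = ∫ z, cost z.1 z.2 ∂(P.map fun ω => (X' ω, (U ω, V ω))) := by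
    refine le_antisymm (hopt.2 _ hpl') ?_
    rw [integral_cost_map mX' hY, integral_cost_map mX hY]
    exact hX'.2 X hX
  have hae := ae_of_ae_map (mX'.prodMk hY).aemeasurable
    ((hpl'.duality hG).2 (hdual.trans (by rw [hint])))
  filter_upwards [hae, hphi G hmax] with ω h1 h2
  rw [h2, h1.1]

end Equilibrium

end KyleOT

theorem theorem6 {Ω : Type*} [MeasurableSpace Ω] (P : Measure Ω) [IsProbabilityMeasure P]
    (U V : Ω → ℝ) (hU : Measurable U) (hV : Measurable V)
    (hU2 : MemLp U 2 P) (hV2 : MemLp V 2 P)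
    (Y : Ω → ℝ × ℝ) (hY : Y = fun ω => (U ω, V ω))
    (ν : Measure (ℝ × ℝ)) (hν : ν = P.map Y) :
    -- existence of an equilibrium
    ((∃ (Q : Ω → ℝ) (f : ℝ → EReal), KyleOT.IsEquilibrium P U V Q f) ↔
      ∃ X : Ω → ℝ × ℝ, KyleOT.IsOptimalMap P Y X ∧
        KyleOT.IsOptimalPlan ν (P.map fun ω => (X ω, Y ω))) ∧
    -- the profit is the same in all equilibria
    (∀ (Q Q' : Ω → ℝ) (f f' : ℝ → EReal),
      KyleOT.IsEquilibrium P U V Q f → KyleOT.IsEquilibrium P U V Q' f' →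
      ∀ᵐ ω ∂P, KyleOT.profit f (U ω) (V ω) (Q ω) = KyleOT.profit f' (U ω) (V ω) (Q' ω)) ∧
    -- the value of the profit
    (∀ (Q : Ω → ℝ) (f : ℝ → EReal), KyleOT.IsEquilibrium P U V Q f →
      (∃ G : Set (ℝ × ℝ), KyleOT.IsDualMaximizer ν G) ∧
      (∀ X : Ω → ℝ × ℝ, KyleOT.IsOptimalMap P Y X →
        ∀ᵐ ω ∂P, KyleOT.profit f (U ω) (V ω) (Q ω) =
          -((KyleOT.cost (X ω) (Y ω) : ℝ) : EReal)) ∧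
      (∀ G : Set (ℝ × ℝ), KyleOT.IsDualMaximizer ν G →
        ∀ᵐ ω ∂P, KyleOT.profit f (U ω) (V ω) (Q ω) = -KyleOT.phi G (U ω, V ω))) ∧
    -- an equilibrium with an increasing pricing rule
    ((∃ (Q : Ω → ℝ) (f : ℝ → EReal), KyleOT.IsEquilibrium P U V Q f) →
      ∃ (Q : Ω → ℝ) (f : ℝ → EReal) (R S : Ω → ℝ),
        KyleOT.IsEquilibrium P U V Q f ∧
        KyleOT.IsOptimalMap P Y (fun ω => (R ω, S ω)) ∧
        KyleOT.IsOptimalPlan ν (P.map fun ω => ((R ω, S ω), Y ω)) ∧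
        Monotone f ∧
        (∀ᵐ ω ∂P, Q ω + U ω = R ω) ∧
        (∀ᵐ ω ∂P, f (Q ω + U ω) = ((S ω : ℝ) : EReal))) := by
  subst hY hν
  refine ⟨⟨?_, ?_⟩, ?_, ?_, ?_⟩
  · rintro ⟨Q, f, h⟩
    exact (h.exists_optimal hU hV hU2 hV2).1
  · rintro ⟨X, hX, hopt⟩
    obtain ⟨Q, f, R, S, h, -⟩ := KyleOT.exists_monotone_equilibrium hU hV hU2 hV2 hX.1 hopt
    exact ⟨Q, f, h⟩
  · intro Q Q' f f' h h'
    obtain ⟨⟨X, hX, -⟩, -, hprofit, -⟩ := h.exists_optimal hU hV hU2 hV2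
    filter_upwards [hprofit X hX, (h'.exists_optimal hU hV hU2 hV2).2.2.1 X hX] with ω h1 h2
    rw [h1, h2]
  · intro Q f h
    exact (h.exists_optimal hU hV hU2 hV2).2
  · rintro ⟨Q, f, h⟩
    obtain ⟨X, hX, hopt⟩ := (h.exists_optimal hU hV hU2 hV2).1
    exact KyleOT.exists_monotone_equilibrium hU hV hU2 hV2 hX.1 hopt
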